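/- Let $M$ and $P$ be smooth manifolds (Hausdorff, second countable, each of some fixed finite dimension), let $V\to M$ be a smooth real vector bundle of (constant) finite rank, and let $D\subset V$ be a smooth singular subbundle, i.e. a family of linear subspaces $D_m\subset V_m$ $(m\in M)$ such that through every $v\in D_m$ there passes a smooth section $\sigma:M\to V$ with $\sigma(m)=v$ and $\sigma(x)\in D_x$ for all $x\in M$. Give $D$ the subspace diffeology of $V$ and $V/D=\bigsqcup_m V_m/D_m$ the quotient diffeology of $V$ (plots are the maps that locally lift to smooth maps into $V$). For a family of real vector spaces $E\to M$ whose total space carries a diffeology for which the projection, zero section, fibrewise addition and scalar multiplication are smooth, let $\Gamma(E)$ be the $C^\infty(M)$-module of its smooth sections. For a smooth map $\pi:P\to M$ let $\pi^*E=P\times_M E\to P$ be the pullback, with the diffeology of the fibre product, and let $$\alpha_E:\ C^\infty(P)\otimes_{C^\infty(M)}\Gamma(E)\to\Gamma(\pi^*E),\qquad f\otimes\sigma\mapsto f\cdot(\sigma\circ\pi),$$ where $C^\infty(P)$ is a $C^\infty(M)$-algebra through $g\mapsto g\circ\pi$. Suppose that $\pi:P\to M$ is a submersion and that $\Gamma(D)$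 is a finitely generated $C^\infty(M)$-module. Then the $C^\infty(P)$-linear map $\alpha_{V/D}: C^\infty(P)\otimes_{C^\infty(M)}\Gamma(V/D)\to\Gamma(\pi^*(V/D))$ is bijective, and, with $\pi^*D\subset\pi^*V$ the family $(\pi^*D)_p=D_{\pi(p)}$, there is an isomorphism of $C^\infty(P)$-modules $$C^\infty(P)\otimes_{C^\infty(M)}\Gamma(V/D)\ \cong\ \Gamma(\pi^*V/\pi^*D)$$ that sends $f\otimes\sigma$ to the section $p\mapsto f(p)\,\sigma(\pi(p))\in V_{\pi(p)}/D_{\pi(p)}$. -/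

import Mathlib

open scoped Manifold ContDiff TensorProduct Topology

noncomputable section

namespace Tepui

/-! ### Diffeologies -/

/-- A point of an open set of `ℝᵏ` has a neighbourhood on which the identity extends to a smooth
map from all of `ℝᵏ` into the open set. -/
theorem exists_smooth_retract {k : ℕ} {u : Set (EuclideanSpace ℝ (Fin k))} (hu : IsOpen u)
    {x : EuclideanSpace ℝ (Fin k)} (hx : x ∈ u) :
    ∃ f : EuclideanSpace ℝ (Fin k) → EuclideanSpace ℝ (Fin k),
      ContDiff ℝ ∞ f ∧ (∀ y, f y ∈ u) ∧ f =ᶠ[𝓝 x] id := by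
  obtain ⟨ε, hε, hball⟩ := Metric.isOpen_iff.mp hu x hx
  let χ : ContDiffBump x := ⟨ε / 2, ε, by positivity, by linarith⟩
  refine ⟨fun y ↦ x + χ y • (y - x), ?_, ?_, ?_⟩
  · exact contDiff_const.add (χ.contDiff.smul (contDiff_id.sub contDiff_const))
  · intro y
    apply hball
    rw [mem_ball_iff_norm, add_sub_cancel_left, norm_smul, Real.norm_of_nonneg χ.nonneg]
    by_cases hy : ‖y - x‖ < ε
    · exact lt_of_le_of_lt (mul_le_of_le_one_left (norm_nonneg _) χ.le_one) hy
    · have h0 : χ y = 0 := χ.zero_of_le_dist (by rw [dist_eq_norm]; exact not_lt.mp hy)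
      rw [h0, zero_mul]
      exact hε
  · filter_upwards [χ.eventuallyEq_one] with y hy
    simp [hy]

/-- The standard diffeology of a smooth manifold: the plots are the smooth maps. -/
@[reducible]
def manifoldDiffeology {E : Type*} [NormedAddCommGroup E] [NormedSpace ℝ E] {H : Type*}
    [TopologicalSpace H] (I : ModelWithCorners ℝ E H) (M : Type*) [TopologicalSpace M]
    [ChartedSpace H M] : DiffeologicalSpace M where
  plots k := {p | ContMDiff (𝓡 k) I ∞ p}
  constant_plots _ := contMDiff_const
  plot_reparam hp hf := hp.comp hf.contMDiff
  locality := by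
    intro k p hp x
    obtain ⟨u, hu, hxu, h⟩ := hp x
    obtain ⟨f, hf, hfu, hfx⟩ := exists_smooth_retract hu hxu
    have h1 : ContMDiff (𝓡 k) I ∞ (p ∘ f) := h hfu hf
    refine (h1 x).congr_of_eventuallyEq ?_
    filter_upwards [hfx] with y hy
    simp [hy]

/-- The diffeology on `Y` induced by a map `f : Y → X`: a map to `Y` is a plot iff its composite
with `f` is one. For injective `f` this is the subspace diffeology. -/
@[reducible]
def inducedDiffeology {X Y : Type*} (d : DiffeologicalSpace X) (f : Y → X) :
    DiffeologicalSpace Y where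
  plots k := {p | f ∘ p ∈ d.plots k}
  constant_plots _ := d.constant_plots _
  plot_reparam hp hf := d.plot_reparam hp hf
  locality := by
    intro k p hp
    refine d.locality fun x ↦ ?_
    obtain ⟨u, hu, hxu, h⟩ := hp x
    exact ⟨u, hu, hxu, fun hfu hf ↦ h hfu hf⟩

/-- The quotient diffeology along a surjection `q : X → Y`: the plots are the maps that lift along
`q`, locally, to plots of `X`. -/
@[reducible]
def quotientDiffeology {X Y : Type*} (d : DiffeologicalSpace X) (q : X → Y)
    (hq : Function.Surjective q) : DiffeologicalSpace Y where
  plots k := {p | ∀ x, ∃ g ∈ d.plots k, q ∘ g =ᶠ[𝓝 x] p}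
  constant_plots y x := by
    obtain ⟨z, rfl⟩ := hq y
    exact ⟨fun _ ↦ z, d.constant_plots z, Filter.EventuallyEq.rfl⟩
  plot_reparam := by
    intro k l p f hp hf x
    obtain ⟨g, hg, hgp⟩ := hp (f x)
    exact ⟨g ∘ f, d.plot_reparam hg hf, hgp.comp_tendsto hf.continuous.continuousAt⟩
  locality := by
    intro k p hp x
    obtain ⟨u, hu, hxu, h⟩ := hp x
    obtain ⟨f, hf, hfu, hfx⟩ := exists_smooth_retract hu hxu
    obtain ⟨g, hg, hgp⟩ := h hfu hf x
    refine ⟨g, hg, hgp.trans ?_⟩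
    filter_upwards [hfx] with y hy
    simp [hy]

/-! ### Bundles of vector spaces and their sections -/

section Bundles

variable {E : Type*} [NormedAddCommGroup E] [NormedSpace ℝ E] {H : Type*} [TopologicalSpace H]
  (I : ModelWithCorners ℝ E H) (M : Type*) [TopologicalSpace M] [ChartedSpace H M]

/-- A (diffeological) bundle of vector spaces over the manifold `M`: a family of real vector spaces
and a diffeology on its total space such that the projection, the zero section, the fibrewise
addition (defined on the fibre product) and the scalar multiplication are smooth. There is no local
triviality. The last two conditions are spelled out on plots: a plot of the fibre product of the
total space with itself is a pair of plots over the same map to `M`. -/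
structure VectorSpaceBundle where
  fiber : M → Type*
  [addCommGroup : ∀ m, AddCommGroup (fiber m)]
  [module : ∀ m, Module ℝ (fiber m)]
  diffeology : DiffeologicalSpace (Σ m, fiber m)
  smooth_proj : @Diffeology.DSmooth _ _ diffeology (manifoldDiffeology I M) Sigma.fst
  smooth_zero : @Diffeology.DSmooth _ _ (manifoldDiffeology I M) diffeology (fun m ↦ ⟨m, 0⟩)
  smooth_add : ∀ (k : ℕ) (c : EuclideanSpace ℝ (Fin k) → M) (s t : ∀ x, fiber (c x)),
    (fun x ↦ ⟨c x, s x⟩) ∈ diffeology.plots k → (fun x ↦ ⟨c x, t x⟩) ∈ diffeology.plots k →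
    (fun x ↦ ⟨c x, s x + t x⟩) ∈ diffeology.plots k
  smooth_smul : ∀ (k : ℕ) (r : EuclideanSpace ℝ (Fin k) → ℝ)
    (c : EuclideanSpace ℝ (Fin k) → M) (s : ∀ x, fiber (c x)),
    ContDiff ℝ ∞ r → (fun x ↦ ⟨c x, s x⟩) ∈ diffeology.plots k →
    (fun x ↦ ⟨c x, r x • s x⟩) ∈ diffeology.plots k

attribute [instance] VectorSpaceBundle.addCommGroup VectorSpaceBundle.module

variable {I M}

namespace VectorSpaceBundle

/-- The group `Γ(B)` of smooth sections of a bundle of vector spaces. -/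
def sections (B : VectorSpaceBundle I M) : AddSubgroup (∀ m, B.fiber m) where
  carrier := {s | @Diffeology.DSmooth _ _ (manifoldDiffeology I M) B.diffeology
    (fun m ↦ (⟨m, s m⟩ : Σ m, B.fiber m))}
  zero_mem' := B.smooth_zero
  add_mem' hs ht k c hc := B.smooth_add k c _ _ (hs k c hc) (ht k c hc)
  neg_mem' := by
    intro s hs k c hc
    have := B.smooth_smul k (fun _ ↦ -1) c (fun x ↦ s (c x)) contDiff_const (hs k c hc)
    simpa [Function.comp_def, Diffeology.IsPlot] using this

/-- `Γ(B)` is a module over the ring of smooth functions, by pointwise multiplication. -/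
instance (B : VectorSpaceBundle I M) : Module C^∞⟮I, M; ℝ⟯ B.sections where
  smul f s := ⟨fun m ↦ f m • s.1 m, fun k c hc ↦
    B.smooth_smul k (fun x ↦ f (c x)) c _ (f.contMDiff.comp hc).contDiff (s.2 k c hc)⟩
  one_smul s := Subtype.ext (funext fun m ↦ one_smul ℝ (s.1 m))
  mul_smul f g s := Subtype.ext (funext fun m ↦ mul_smul (f m) (g m) (s.1 m))
  smul_zero f := Subtype.ext (funext fun m ↦ smul_zero (f m))
  smul_add f s t := Subtype.ext (funext fun m ↦ smul_add (f m) (s.1 m) (t.1 m))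
  add_smul f g s := Subtype.ext (funext fun m ↦ add_smul (f m) (g m) (s.1 m))
  zero_smul s := Subtype.ext (funext fun m ↦ zero_smul ℝ (s.1 m))

/-- A singular subbundle `D` (a family of subspaces), as a bundle of vector spaces with the
subspace diffeology. -/
def sub (B : VectorSpaceBundle I M) (D : ∀ m, Submodule ℝ (B.fiber m)) :
    VectorSpaceBundle I M where
  fiber m := D m
  diffeology := inducedDiffeology B.diffeology (fun v ↦ ⟨v.1, v.2.1⟩)
  smooth_proj k _ hp := B.smooth_proj k _ hp
  smooth_zero k c hc := B.smooth_zero k c hc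
  smooth_add k c s t hs ht := B.smooth_add k c (fun x ↦ (s x).1) (fun x ↦ (t x).1) hs ht
  smooth_smul k r c s hr hs := B.smooth_smul k r c (fun x ↦ (s x).1) hr hs

/-- The fibrewise quotient map on total spaces. -/
def quotientMap (B : VectorSpaceBundle I M) (D : ∀ m, Submodule ℝ (B.fiber m)) :
    (Σ m, B.fiber m) → Σ m, B.fiber m ⧸ D m :=
  fun v ↦ ⟨v.1, Submodule.Quotient.mk v.2⟩

theorem quotientMap_surjective (B : VectorSpaceBundle I M) (D : ∀ m, Submodule ℝ (B.fiber m)) :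
    Function.Surjective (B.quotientMap D) := by
  rintro ⟨m, v⟩
  obtain ⟨w, rfl⟩ := Submodule.Quotient.mk_surjective _ v
  exact ⟨⟨m, w⟩, rfl⟩

/-- A plot of the quotient, lying over `c`, has local lifts that lie over `c`. -/
theorem exists_lift_over (B : VectorSpaceBundle I M) (D : ∀ m, Submodule ℝ (B.fiber m)) {k : ℕ}
    {c : EuclideanSpace ℝ (Fin k) → M} {s : ∀ x, B.fiber (c x) ⧸ D (c x)}
    (hs : (fun x ↦ (⟨c x, s x⟩ : Σ m, B.fiber m ⧸ D m)) ∈ (quotientDiffeology B.diffeology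
      (B.quotientMap D) (B.quotientMap_surjective D)).plots k) (x : EuclideanSpace ℝ (Fin k)) :
    ∃ u : Set (EuclideanSpace ℝ (Fin k)), IsOpen u ∧ x ∈ u ∧
      ∀ f : EuclideanSpace ℝ (Fin k) → EuclideanSpace ℝ (Fin k), ContDiff ℝ ∞ f →
        (∀ y, f y ∈ u) → ∃ g : ∀ y, B.fiber (c (f y)),
          (fun y ↦ (⟨c (f y), g y⟩ : Σ m, B.fiber m)) ∈ B.diffeology.plots k ∧
          ∀ y, Submodule.Quotient.mk (g y) = s (f y) := by
  obtain ⟨g, hg, hgs⟩ := hs x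
  obtain ⟨u, hu, huo, hxu⟩ := eventually_nhds_iff.mp hgs
  refine ⟨u, huo, hxu, fun f hf hfu ↦ ?_⟩
  have aux : ∀ (m : M) (a : B.fiber m ⧸ D m) (z : Σ m, B.fiber m),
      B.quotientMap D z = ⟨m, a⟩ → ∃ w : B.fiber m, z = ⟨m, w⟩ ∧ Submodule.Quotient.mk w = a := by
    rintro m a ⟨m', w⟩ h
    obtain ⟨rfl, h2⟩ := Sigma.mk.inj_iff.mp h
    exact ⟨w, rfl, eq_of_heq h2⟩
  have key : ∀ y, ∃ w : B.fiber (c (f y)), g (f y) = ⟨c (f y), w⟩ ∧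
      Submodule.Quotient.mk w = s (f y) := fun y ↦ aux _ _ _ (hu (f y) (hfu y))
  choose w hw hws using key
  refine ⟨w, ?_, hws⟩
  have : (fun y ↦ (⟨c (f y), w y⟩ : Σ m, B.fiber m)) = g ∘ f := funext fun y ↦ (hw y).symm
  rw [this]
  exact B.diffeology.plot_reparam hg hf

/-- The quotient `B / D` of a bundle of vector spaces by a singular subbundle, with the quotient
diffeology. -/
def quotient (B : VectorSpaceBundle I M) (D : ∀ m, Submodule ℝ (B.fiber m)) :
    VectorSpaceBundle I M where
  fiber m := B.fiber m ⧸ D m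
  diffeology := quotientDiffeology B.diffeology (B.quotientMap D) (B.quotientMap_surjective D)
  smooth_proj := by
    intro k p hp x
    obtain ⟨g, hg, hgp⟩ := hp x
    have h1 : ContMDiff (𝓡 k) I ∞ (Sigma.fst ∘ g) := B.smooth_proj k g hg
    refine (h1 x).congr_of_eventuallyEq ?_
    filter_upwards [hgp] with y hy
    simp [← hy, quotientMap]
  smooth_zero := by
    intro k c hc x
    exact ⟨_, B.smooth_zero k c hc, Filter.EventuallyEq.rfl⟩
  smooth_add := by
    intro k c s t hs ht x
    obtain ⟨u, huo, hxu, hu⟩ := B.exists_lift_over D hs x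
    obtain ⟨v, hvo, hxv, hv⟩ := B.exists_lift_over D ht x
    obtain ⟨f, hf, hfuv, hfx⟩ := exists_smooth_retract (huo.inter hvo) ⟨hxu, hxv⟩
    obtain ⟨g, hg, hgs⟩ := hu f hf fun y ↦ (hfuv y).1
    obtain ⟨h, hh, hht⟩ := hv f hf fun y ↦ (hfuv y).2
    refine ⟨_, B.smooth_add k (c ∘ f) g h hg hh, ?_⟩
    filter_upwards [hfx] with y hy
    have : B.quotientMap D ⟨c (f y), g y + h y⟩ = ⟨c (f y), s (f y) + t (f y)⟩ := by
      rw [← hgs y, ← hht y]; rfl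
    refine this.trans ?_
    rw [hy]; rfl
  smooth_smul := by
    intro k r c s hr hs x
    obtain ⟨u, huo, hxu, hu⟩ := B.exists_lift_over D hs x
    obtain ⟨f, hf, hfu, hfx⟩ := exists_smooth_retract huo hxu
    obtain ⟨g, hg, hgs⟩ := hu f hf hfu
    refine ⟨_, B.smooth_smul k (r ∘ f) (c ∘ f) g (hr.comp hf) hg, ?_⟩
    filter_upwards [hfx] with y hy
    have : B.quotientMap D ⟨c (f y), r (f y) • g y⟩ = ⟨c (f y), r (f y) • s (f y)⟩ := by
      rw [← hgs y]; rfl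
    refine this.trans ?_
    rw [hy]; rfl

end VectorSpaceBundle

/-! ### Smooth vector bundles and smooth singular subbundles -/

variable (I) (F : Type*) [NormedAddCommGroup F] [NormedSpace ℝ F] (V : M → Type*)
  [TopologicalSpace (Bundle.TotalSpace F V)] [∀ m, AddCommGroup (V m)] [∀ m, Module ℝ (V m)]
  [∀ m, TopologicalSpace (V m)] [FiberBundle F V]

section

variable [VectorBundle ℝ F V]

/-- A smooth vector bundle, as a bundle of vector spaces: its total space carries its
manifold diffeology. -/
def ofVectorBundle [ContMDiffVectorBundle ∞ F V I] : VectorSpaceBundle I M where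
  fiber := V
  diffeology := inducedDiffeology
    (manifoldDiffeology (I.prod 𝓘(ℝ, F)) (Bundle.TotalSpace F V)) (fun v ↦ ⟨v.1, v.2⟩)
  smooth_proj := by
    intro k p hp
    exact (Bundle.contMDiff_proj V (n := ∞) (IB := I)).comp hp
  smooth_zero := by
    intro k c hc
    exact (Bundle.contMDiff_zeroSection ℝ V (n := ∞) (IB := I)).comp hc
  smooth_add := by
    intro k c s t hs ht x
    have hs' := Bundle.contMDiffAt_totalSpace.mp (hs x)
    have ht' := Bundle.contMDiffAt_totalSpace.mp (ht x)
    refine Bundle.contMDiffAt_totalSpace.mpr ⟨hs'.1, (hs'.2.add ht'.2).congr_of_eventuallyEq ?_⟩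
    have hc : ContinuousAt c x := hs'.1.continuousAt
    filter_upwards [hc.preimage_mem_nhds ((trivializationAt F V (c x)).open_baseSet.mem_nhds
      (FiberBundle.mem_baseSet_trivializationAt' (c x)))] with y hy
    exact ((trivializationAt F V (c x)).linear ℝ hy).map_add (s y) (t y)
  smooth_smul := by
    intro k r c s hr hs x
    have hs' := Bundle.contMDiffAt_totalSpace.mp (hs x)
    refine Bundle.contMDiffAt_totalSpace.mpr
      ⟨hs'.1, ((hr.contMDiff x).smul hs'.2).congr_of_eventuallyEq ?_⟩
    have hc : ContinuousAt c x := hs'.1.continuousAt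
    filter_upwards [hc.preimage_mem_nhds ((trivializationAt F V (c x)).open_baseSet.mem_nhds
      (FiberBundle.mem_baseSet_trivializationAt' (c x)))] with y hy
    exact ((trivializationAt F V (c x)).linear ℝ hy).map_smul (r y) (s y)

end

/-- A singular subbundle `D` of `V` is smooth if through each of its vectors passes a global
smooth section of `V` with values in `D`. -/
def IsSmoothSubbundle (D : ∀ m, Submodule ℝ (V m)) : Prop :=
  ∀ m, ∀ v ∈ D m, ∃ σ : Cₛ^∞⟮I; F, V⟯, σ m = v ∧ ∀ x, σ x ∈ D x

end Bundles

/-! ### Algebraic and geometric base change -/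

section BaseChange

variable {E : Type*} [NormedAddCommGroup E] [NormedSpace ℝ E] {H : Type*} [TopologicalSpace H]
  {I : ModelWithCorners ℝ E H} {M : Type*} [TopologicalSpace M] [ChartedSpace H M]
  {E' : Type*} [NormedAddCommGroup E'] [NormedSpace ℝ E'] {H' : Type*} [TopologicalSpace H']
  {J : ModelWithCorners ℝ E' H'} {P : Type*} [TopologicalSpace P] [ChartedSpace H' P]

instance pullbackAddCommGroup (π : P → M) (V : M → Type*) [∀ m, AddCommGroup (V m)] (p : P) :
    AddCommGroup ((π *ᵖ V) p) :=
  inferInstanceAs (AddCommGroup (V (π p)))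

/-- The pullback `π^* B` of a bundle of vector spaces: the fibre product of `P` and the total space
of `B`, so that a plot is a pair of plots of `P` and of the total space of `B` over the
same map to `M`. -/
def VectorSpaceBundle.pullback (π : C^∞⟮J, P; I, M⟯) (B : VectorSpaceBundle I M) :
    VectorSpaceBundle J P where
  fiber p := B.fiber (π p)
  diffeology := inducedDiffeology (manifoldDiffeology J P) Sigma.fst ⊓
    inducedDiffeology B.diffeology (fun v ↦ ⟨π v.1, v.2⟩)
  smooth_proj _ _ hp := hp.1
  smooth_zero k c hc := ⟨hc, B.smooth_zero k (π ∘ c) (π.contMDiff.comp hc)⟩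
  smooth_add k c s t hs ht := ⟨hs.1, B.smooth_add k (π ∘ c) s t hs.2 ht.2⟩
  smooth_smul k r c s hr hs := ⟨hs.1, B.smooth_smul k r (π ∘ c) s hr hs.2⟩

/-- The ring homomorphism `f ↦ f ∘ π` from `C^∞(M)` to `C^∞(P)`. -/
def comorphism (π : C^∞⟮J, P; I, M⟯) : C^∞⟮I, M; ℝ⟯ →+* C^∞⟮J, P; ℝ⟯ where
  toFun f := f.comp π
  map_one' := rfl
  map_mul' _ _ := rfl
  map_zero' := rfl
  map_add' _ _ := rfl

/-- `C^∞(P)` as an algebra over `C^∞(M)`. -/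
abbrev comorphismAlgebra (π : C^∞⟮J, P; I, M⟯) : Algebra C^∞⟮I, M; ℝ⟯ C^∞⟮J, P; ℝ⟯ :=
  (comorphism π).toAlgebra

/-- The algebraic base change `π^* Q = C^∞(P) ⊗_{C^∞(M)} Q` of a `C^∞(M)`-module `Q`. -/
abbrev AlgebraicPullback (π : C^∞⟮J, P; I, M⟯) (Q : Type*) [AddCommGroup Q]
    [Module C^∞⟮I, M; ℝ⟯ Q] : Type _ :=
  letI := comorphismAlgebra π
  C^∞⟮J, P; ℝ⟯ ⊗[C^∞⟮I, M; ℝ⟯] Q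

/-- The pure tensor `f ⊗ q`. -/
abbrev AlgebraicPullback.tmul (π : C^∞⟮J, P; I, M⟯) {Q : Type*} [AddCommGroup Q]
    [Module C^∞⟮I, M; ℝ⟯ Q] (f : C^∞⟮J, P; ℝ⟯) (q : Q) : AlgebraicPullback π Q :=
  letI := comorphismAlgebra π
  f ⊗ₜ[C^∞⟮I, M; ℝ⟯] q

/-- The pullback `p ↦ σ (π p)` of a section. -/
def VectorSpaceBundle.pullbackSection (π : C^∞⟮J, P; I, M⟯) (B : VectorSpaceBundle I M)
    (σ : B.sections) : (B.pullback π).sections :=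
  ⟨fun p ↦ σ.1 (π p), fun k c hc ↦ ⟨hc, σ.2 k (π ∘ c) (π.contMDiff.comp hc)⟩⟩

/-- The natural map `α_B : C^∞(P) ⊗_{C^∞(M)} Γ(B) → Γ(π^* B)`, `f ⊗ σ ↦ f • π^* σ`. -/
def VectorSpaceBundle.alpha (π : C^∞⟮J, P; I, M⟯) (B : VectorSpaceBundle I M) :
    AlgebraicPullback π B.sections →ₗ[C^∞⟮J, P; ℝ⟯] (B.pullback π).sections :=
  letI := comorphismAlgebra π
  letI : Module C^∞⟮I, M; ℝ⟯ (B.pullback π).sections :=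
    Module.compHom _ (comorphism π)
  haveI : IsScalarTower C^∞⟮I, M; ℝ⟯ C^∞⟮J, P; ℝ⟯ (B.pullback π).sections :=
    ⟨fun f g s ↦ mul_smul (comorphism π f) g s⟩
  LinearMap.liftBaseChange C^∞⟮J, P; ℝ⟯
    { toFun := B.pullbackSection π
      map_add' := fun _ _ ↦ rfl
      map_smul' := fun _ _ ↦ rfl }

theorem VectorSpaceBundle.alpha_tmul (π : C^∞⟮J, P; I, M⟯) (B : VectorSpaceBundle I M)
    (f : C^∞⟮J, P; ℝ⟯) (σ : B.sections) :
    B.alpha π (AlgebraicPullback.tmul π f σ) = f • B.pullbackSection π σ :=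
  letI := comorphismAlgebra π
  letI : Module C^∞⟮I, M; ℝ⟯ (B.pullback π).sections :=
    Module.compHom _ (comorphism π)
  haveI : IsScalarTower C^∞⟮I, M; ℝ⟯ C^∞⟮J, P; ℝ⟯ (B.pullback π).sections :=
    ⟨fun f g s ↦ mul_smul (comorphism π f) g s⟩
  LinearMap.liftBaseChange_tmul _ _ _ _

end BaseChange

end Tepui

end

/-!
Everything rests on two facts about smooth sections.

*Finite frames.* The bundle `V` has sections `e₁, …, e_N` and a smooth family of linear maps
`A : V_x → ℝᴺ` with `∑ A(v)_a e_a = v` for all `v` (`exists_finite_frame`). The number `N` is finite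
although `M` need not be compact: over a compact set there is a fibrewise injective `A`, and as the
range of `A` has Hausdorff dimension at most `dim M + rank V`, projections along lines outside the
range lower the dimension of the target to `dim M + rank V`. The families over an exhaustion of `M`
are then combined with two systems of bump functions with disjoint supports. The frame is the
pseudo-inverse of `A`.

*Generators of `Γ(π^* D)`.* If `δ₁, …, δ_k` generate `Γ(D)`, then the `δ_j ∘ π` generate `Γ(π^* D)`
(`exists_coefficients_of_isSubmersion`). In charts in which `π` is a linear projection `E × Y → E`,
this says that a smooth family `s(x, y) ∈ D_x` of sections, with parameter `y`, has coefficients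
that depend smoothly on `(x, y)` (`GeneratesSections.prod`). By induction on `dim Y` it is enough to
take `Y = ℝ`. The Fourier coefficients of `s` in the variable `y` are sections of `D` that decrease
rapidly, with all their derivatives, and have to be written in terms of the `δ_j` with rapidly
decreasing coefficient functions. This is an open mapping theorem for the surjection from
`k`-tuples of functions to `Γ(D)`, although `Γ(D)` need not be closed: the relation "`f` is a tuple
of coefficients of `∑ cₙ aₙ`" between `c ∈ ℓ¹` and smooth `f` with support in a fixed compact set is
total, and stable under rapidly converging series, so that Baire's theorem bounds coefficients in
each seminorm (`exists_bounded_lift`, `exists_rapid_lift`).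

The theorem follows by algebra. Sections of `V / D` and of `π^* (V / D)` lift to sections of `V` and
of `π^* V` by partitions of unity, so that the classes of the `e_a` generate `Γ(V / D)` and their
pullbacks generate `Γ(π^* (V / D))`: the map `α` is surjective. If `∑ f_a ⊗ [e_a]` is in its kernel,
then `∑ f_a e_a ∘ π` is a section of `π^* D`, hence equals `∑ h_j δ_j ∘ π`, and `∑ h_j ⊗ [δ_j] = 0`.
It remains to see that `∑ c_a ⊗ [e_a] = 0` if `∑ c_a e_a ∘ π = 0`, which is clear after `[e_b]` is
replaced by `∑ A(e_b)_a [e_a]`.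
-/

noncomputable section

namespace Tepui

/-! ### Bounded lifts along a linear relation -/

section BoundedLift

variable {X : Type*} [NormedAddCommGroup X] [NormedSpace ℝ X] {Z : Type*} [AddCommGroup Z]
  [Module ℝ Z]

/-- The first half of the open mapping theorem, for a linear relation `R` that is onto a Banach
space: by Baire's theorem the vectors with a lift of seminorm at most `1` are dense in a ball. -/
theorem exists_ball_approx_lift [CompleteSpace X] (p : Seminorm ℝ Z) (R : Submodule ℝ (X × Z))
    (hsurj : ∀ c, ∃ f, (c, f) ∈ R) :
    ∃ δ > 0, ∀ x : X, ‖x‖ < δ → ∀ ε > 0, ∃ c f, (c, f) ∈ R ∧ p f ≤ 1 ∧ ‖x - c‖ < ε := by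
  let S : ℕ → Set X := fun n ↦ {c | ∃ f, (c, f) ∈ R ∧ p f ≤ n}
  have hU : ⋃ n, closure (S n) = Set.univ := by
    refine Set.eq_univ_of_forall fun x ↦ ?_
    obtain ⟨f, hf⟩ := hsurj x
    obtain ⟨n, hn⟩ := exists_nat_ge (p f)
    exact Set.mem_iUnion.mpr ⟨n, subset_closure ⟨f, hf, hn⟩⟩
  obtain ⟨n, a, ha⟩ := nonempty_interior_of_iUnion_of_closed (fun n ↦ isClosed_closure) hU
  obtain ⟨r, hr, hball⟩ := Metric.isOpen_iff.mp isOpen_interior a ha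
  have hcl : ∀ y : X, ‖y‖ < r → ∀ ε > 0, ∃ c f, (c, f) ∈ R ∧ p f ≤ n ∧ ‖(a + y) - c‖ < ε := by
    intro y hy ε hε
    have : a + y ∈ closure (S n) := interior_subset (hball (by simpa [Metric.mem_ball] using hy))
    obtain ⟨c, ⟨f, hf, hpf⟩, hc⟩ := Metric.mem_closure_iff.mp this ε hε
    exact ⟨c, f, hf, hpf, by rwa [← dist_eq_norm]⟩
  have hn1 : (0 : ℝ) < n + 1 := by positivity
  refine ⟨r / (n + 1), by positivity, fun x hx ε hε ↦ ?_⟩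
  have hx' : ‖((n : ℝ) + 1) • x‖ < r := by
    rw [norm_smul, Real.norm_of_nonneg hn1.le]
    rwa [lt_div_iff₀' hn1] at hx
  obtain ⟨c, f, hcf, hf, hc⟩ := hcl _ hx' ε hε
  obtain ⟨d, g, hdg, hg, hd⟩ := hcl (-(((n : ℝ) + 1) • x)) (by rwa [norm_neg]) ε hε
  refine ⟨(1 / (2 * ((n : ℝ) + 1))) • (c - d), (1 / (2 * ((n : ℝ) + 1))) • (f - g),
    R.smul_mem _ (R.sub_mem hcf hdg), ?_, ?_⟩
  · rw [map_smul_eq_mul, Real.norm_of_nonneg (by positivity)]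
    have : p (f - g) ≤ n + n := (map_sub_le_add p f g).trans (add_le_add hf hg)
    rw [one_div, inv_mul_le_iff₀ (by positivity)]
    linarith
  · have h1 : x - (1 / (2 * ((n : ℝ) + 1))) • (c - d) = (1 / (2 * ((n : ℝ) + 1))) •
        ((a + ((n : ℝ) + 1) • x - c) - (a + -(((n : ℝ) + 1) • x) - d)) := by
      have h2 : (a + ((n : ℝ) + 1) • x - c) - (a + -(((n : ℝ) + 1) • x) - d)
          = (2 * ((n : ℝ) + 1)) • x - (c - d) := by module
      rw [h2, smul_sub _ _ (c - d), smul_smul, one_div_mul_cancel (by positivity), one_smul]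
    rw [h1, norm_smul, Real.norm_of_nonneg (by positivity), one_div,
      inv_mul_lt_iff₀ (by positivity)]
    refine (norm_sub_le _ _).trans_lt ?_
    nlinarith [Nat.cast_nonneg (α := ℝ) n]

/-- An open mapping theorem. Let `R` be a linear relation, onto a Banach space `X`, with values in a
space `Z` with an increasing sequence of seminorms, such that `R` contains the sums of the series
of its elements that converge fast. Then each seminorm is bounded on suitable lifts. -/
theorem exists_bounded_lift [CompleteSpace X] (p : ℕ → Seminorm ℝ Z) (R : Submodule ℝ (X × Z))
    (hsurj : ∀ c, ∃ f, (c, f) ∈ R)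
    (hsum : ∀ (j : ℕ) (c : ℕ → X) (f : ℕ → Z) (x : X), (∀ i, (c i, f i) ∈ R) → HasSum c x →
      (∀ i, p (j + i) (f i) ≤ (1 / 2) ^ i) → ∃ g, (x, g) ∈ R ∧ p j g ≤ 2) (j : ℕ) :
    ∃ C : ℝ, ∀ x, ∃ g, (x, g) ∈ R ∧ p j g ≤ C * ‖x‖ := by
  choose δ hδ happrox using fun j ↦ exists_ball_approx_lift (p j) R hsurj
  let η : ℕ → ℝ := fun i ↦ (1 / 2) ^ i * min (δ (j + i)) 1
  have hη : ∀ i, 0 < η i := fun i ↦ mul_pos (by positivity) (lt_min (hδ _) one_pos)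
  have hη1 : ∀ i, η i ≤ (1 / 2) ^ i := fun i ↦
    mul_le_of_le_one_right (by positivity) (min_le_right _ _)
  have step : ∀ (i : ℕ) (x : X), ‖x‖ < η i →
      ∃ c f, (c, f) ∈ R ∧ p (j + i) f ≤ (1 / 2) ^ i ∧ ‖x - c‖ < η (i + 1) := by
    intro i x hx
    have h2 : ‖(2 : ℝ) ^ i • x‖ < δ (j + i) := by
      rw [norm_smul, norm_pow, Real.norm_ofNat]
      have : ‖x‖ < (1 / 2) ^ i * δ (j + i) :=
        hx.trans_le (mul_le_mul_of_nonneg_left (min_le_left _ _) (by positivity))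
      calc (2 : ℝ) ^ i * ‖x‖ < 2 ^ i * ((1 / 2) ^ i * δ (j + i)) := by gcongr
        _ = δ (j + i) := by rw [← mul_assoc, ← mul_pow]; norm_num
    obtain ⟨c, f, hcf, hf, hc⟩ := happrox (j + i) _ h2 (2 ^ i * η (i + 1))
      (mul_pos (by positivity) (hη _))
    refine ⟨(1 / 2 : ℝ) ^ i • c, (1 / 2 : ℝ) ^ i • f, R.smul_mem _ hcf, ?_, ?_⟩
    · rw [map_smul_eq_mul, Real.norm_of_nonneg (by positivity)]
      exact mul_le_of_le_one_right (by positivity) hf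
    · have h1 : x - (1 / 2 : ℝ) ^ i • c = (1 / 2 : ℝ) ^ i • ((2 : ℝ) ^ i • x - c) := by
        rw [smul_sub, smul_smul, ← mul_pow]; norm_num
      rw [h1, norm_smul, Real.norm_of_nonneg (by positivity)]
      calc (1 / 2 : ℝ) ^ i * ‖(2 : ℝ) ^ i • x - c‖ < (1 / 2) ^ i * (2 ^ i * η (i + 1)) := by gcongr
        _ = η (i + 1) := by rw [← mul_assoc, ← mul_pow]; norm_num
  choose! c f hcf hf hc using step
  have main : ∀ x, ‖x‖ < η 0 → ∃ g, (x, g) ∈ R ∧ p j g ≤ 2 := by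
    intro x hx
    -- the successive errors of the approximations to `x`
    let y : ℕ → X := fun i ↦ Nat.rec x (fun i z ↦ z - c i z) i
    have hy : ∀ i, ‖y i‖ < η i := by
      intro i
      induction i with
      | zero => exact hx
      | succ i ih => exact hc i _ ih
    have hcy : ∀ i, c i (y i) = y i - y (i + 1) := fun i ↦ (sub_sub_cancel _ _).symm
    refine hsum j (fun i ↦ c i (y i)) (fun i ↦ f i (y i)) x (fun i ↦ hcf i _ (hy i)) ?_
      (fun i ↦ hf i _ (hy i))
    have hlim : Filter.Tendsto y Filter.atTop (𝓝 0) := by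
      refine squeeze_zero_norm (fun i ↦ (hy i).le.trans (hη1 i)) ?_
      exact tendsto_pow_atTop_nhds_zero_of_lt_one (by norm_num) (by norm_num)
    have hsm : Summable fun i ↦ c i (y i) := by
      refine Summable.of_norm_bounded
        ((summable_geometric_of_lt_one (r := 1 / 2) (by norm_num) (by norm_num)).mul_left 2)
        fun i ↦ ?_
      rw [hcy]
      have h1 := (hy i).le.trans (hη1 i)
      have h2 := (hy (i + 1)).le.trans (hη1 (i + 1))
      rw [pow_succ] at h2
      have h3 : (0 : ℝ) ≤ (1 / 2) ^ i := by positivity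
      refine (norm_sub_le _ _).trans ?_
      linarith
    refine (hsm.hasSum_iff_tendsto_nat).mpr ?_
    have : (fun n ↦ ∑ i ∈ Finset.range n, c i (y i)) = fun n ↦ x - y n := by
      funext n
      simp_rw [hcy]
      exact Finset.sum_range_sub' y n
    rw [this]
    simpa using hlim.const_sub x
  refine ⟨4 / η 0, fun x ↦ ?_⟩
  rcases eq_or_ne x 0 with rfl | hx
  · exact ⟨0, R.zero_mem, by simp⟩
  · have hx' : 0 < ‖x‖ := norm_pos_iff.mpr hx
    obtain ⟨g, hg, hpg⟩ := main ((η 0 / (2 * ‖x‖)) • x) (by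
      rw [norm_smul, Real.norm_of_nonneg (by have := hη 0; positivity)]
      have := hη 0
      field_simp
      linarith)
    refine ⟨(2 * ‖x‖ / η 0) • g, ?_, ?_⟩
    · have := R.smul_mem (2 * ‖x‖ / η 0) hg
      rwa [Prod.smul_mk, smul_smul, div_mul_div_comm, mul_comm, div_self (by
        have := hη 0; positivity), one_smul] at this
    · have h0 := hη 0
      rw [map_smul_eq_mul, Real.norm_of_nonneg (by positivity)]
      calc 2 * ‖x‖ / η 0 * p j g ≤ 2 * ‖x‖ / η 0 * 2 := by gcongr
        _ = 4 / η 0 * ‖x‖ := by ring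

end BoundedLift

/-! ### Lifting rapidly decreasing sequences -/

section RapidLift

/-- Rapidly decreasing families `g j`, for countably many `j`, stay bounded after division by a
suitable common weight `1 / a`, which is itself rapidly decreasing. -/
theorem exists_rapid_weight {ι κ : Type*} (w : ι → ℝ) (hw : ∀ n, 1 ≤ w n)
    (g : ℕ → ι → κ → ℝ) (hg : ∀ j q : ℕ, ∃ C, ∀ n x, w n ^ q * g j n x ≤ C) :
    ∃ a : ι → ℝ, (∀ n, 0 < a n) ∧ (∀ j, ∃ B, ∀ n x, a n * g j n x ≤ B) ∧
      ∀ q : ℕ, ∃ B, ∀ n, w n ^ q ≤ B * a n := by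
  choose C hC using hg
  -- the coefficients of an entire function that decrease fast enough to absorb all `C j q`
  let ε : ℕ → ℝ := fun q ↦ ((q.factorial : ℝ) * (1 + ∑ j ∈ Finset.range (q + 1), |C j q|))⁻¹
  have hden : ∀ q, 1 ≤ 1 + ∑ j ∈ Finset.range (q + 1), |C j q| := fun q ↦
    le_add_of_nonneg_right (Finset.sum_nonneg fun j _ ↦ abs_nonneg _)
  have hfac : ∀ q : ℕ, (0 : ℝ) < q.factorial := fun q ↦ by exact_mod_cast q.factorial_pos
  have hε : ∀ q, 0 < ε q := fun q ↦
    inv_pos.mpr (mul_pos (hfac q) (one_pos.trans_le (hden q)))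
  have hε1 : ∀ q, ε q ≤ (q.factorial : ℝ)⁻¹ := fun q ↦
    inv_anti₀ (hfac q) (le_mul_of_one_le_right (hfac q).le (hden q))
  have hsum : ∀ n, Summable fun q ↦ ε q * w n ^ q := by
    intro n
    have hw0 : 0 ≤ w n := zero_le_one.trans (hw n)
    refine Summable.of_nonneg_of_le (fun q ↦ mul_nonneg (hε q).le (pow_nonneg hw0 q))
      (fun q ↦ ?_) (Real.summable_pow_div_factorial (w n))
    rw [div_eq_inv_mul]
    exact mul_le_mul_of_nonneg_right (hε1 q) (pow_nonneg hw0 q)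
  have hterm : ∀ n q, ε q * w n ^ q ≤ ∑' q, ε q * w n ^ q := fun n q ↦
    (hsum n).le_tsum q fun i _ ↦
      mul_nonneg (hε i).le (pow_nonneg (zero_le_one.trans (hw n)) i)
  have hsC : ∀ j, Summable fun q ↦ ε q * |C j q| := by
    intro j
    refine Summable.of_norm_bounded_eventually (g := fun q ↦ (q.factorial : ℝ)⁻¹) ?_ ?_
    · simpa using Real.summable_pow_div_factorial 1
    · rw [Nat.cofinite_eq_atTop]
      filter_upwards [Filter.eventually_ge_atTop j] with q hq
      rw [Real.norm_of_nonneg (mul_nonneg (hε q).le (abs_nonneg _))]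
      have h1 : |C j q| ≤ 1 + ∑ j ∈ Finset.range (q + 1), |C j q| := by
        have := Finset.single_le_sum (f := fun j ↦ |C j q|) (fun i _ ↦ abs_nonneg _)
          (Finset.mem_range.mpr (Nat.lt_succ_of_le hq))
        linarith
      have h2 : 0 < 1 + ∑ j ∈ Finset.range (q + 1), |C j q| := one_pos.trans_le (hden q)
      calc ε q * |C j q| ≤ ε q * (1 + ∑ j ∈ Finset.range (q + 1), |C j q|) :=
            mul_le_mul_of_nonneg_left h1 (hε q).le
        _ = (q.factorial : ℝ)⁻¹ := by
            simp only [ε]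
            rw [mul_inv, mul_assoc, inv_mul_cancel₀ h2.ne', mul_one]
  refine ⟨fun n ↦ ∑' q, ε q * w n ^ q, fun n ↦ ?_, fun j ↦ ?_, fun q ↦ ?_⟩
  · exact lt_of_lt_of_le (mul_pos (hε 0) (by simp)) (hterm n 0)
  · refine ⟨∑' q, ε q * |C j q|, fun n x ↦ ?_⟩
    rw [← tsum_mul_right]
    refine Summable.tsum_le_tsum (fun q ↦ ?_) ((hsum n).mul_right _) (hsC j)
    rw [mul_assoc]
    exact mul_le_mul_of_nonneg_left ((hC j q n x).trans (le_abs_self _)) (hε q).le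
  · refine ⟨(ε q)⁻¹, fun n ↦ ?_⟩
    rw [← div_eq_inv_mul, le_div_iff₀' (hε q)]
    exact hterm n q

/-- Lifts that are bounded in one seminorm at a time can be traded for lifts that are bounded in all
seminorms at once, up to any weight `w` that tends to infinity. -/
theorem exists_lift_forall_seminorm_le {ι Z : Type*} [AddCommGroup Z] [Module ℝ Z] (w : ι → ℝ)
    (hw : ∀ n, 1 ≤ w n) (hfin : ∀ C, {n | w n ≤ C}.Finite) (p : ℕ → Seminorm ℝ Z)
    (hp : Monotone p) (r : ι → Z → Prop) (h : ∀ j, ∃ C, ∀ n, ∃ f, r n f ∧ p j f ≤ C) :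
    ∃ f : ι → Z, (∀ n, r n (f n)) ∧ ∀ j, ∃ C, ∀ n, p j (f n) ≤ C * w n := by
  choose C g hg hgC using h
  let J : ι → ℕ := fun n ↦ Nat.findGreatest (fun j ↦ C j ≤ w n) ⌊w n⌋₊
  refine ⟨fun n ↦ g (J n) n, fun n ↦ hg _ n, fun j ↦ ?_⟩
  have hlarge : ∀ n, max (C j) j < w n → p j (g (J n) n) ≤ w n := by
    intro n hn
    have hj : C j ≤ w n := (le_max_left _ _).trans hn.le
    have hj' : j ≤ ⌊w n⌋₊ := Nat.le_floor ((le_max_right _ _).trans hn.le)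
    have h1 : j ≤ J n := Nat.le_findGreatest hj' hj
    have h2 : C (J n) ≤ w n := Nat.findGreatest_spec (P := fun j ↦ C j ≤ w n) hj' hj
    exact (hp h1 _).trans ((hgC _ n).trans h2)
  obtain ⟨B, hB⟩ := ((hfin (max (C j) j)).image fun n ↦ p j (g (J n) n)).bddAbove
  refine ⟨max B 1, fun n ↦ ?_⟩
  have hw0 : 0 ≤ w n := zero_le_one.trans (hw n)
  rcases le_or_gt (w n) (max (C j) j) with hn | hn
  · have h1 : p j (g (J n) n) ≤ B := hB ⟨n, hn, rfl⟩
    exact h1.trans ((le_max_left _ _).trans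
      (le_mul_of_one_le_right (zero_le_one.trans (le_max_right _ _)) (hw n)))
  · exact (hlarge n hn).trans (le_mul_of_one_le_left hw0 (le_max_right _ _))

open ContDiffMapSupportedIn Distributions

variable {E F : Type*} [NormedAddCommGroup E] [NormedSpace ℝ E] [NormedAddCommGroup F]
  [NormedSpace ℝ F]

theorem tsum_mem_submodule [FiniteDimensional ℝ F] {ι : Type*} (S : Submodule ℝ F)
    {f : ι → F} (hf : ∀ i, f i ∈ S) :
    ∑' i, f i ∈ S := by
  by_cases h : Summable f
  · exact S.closed_of_finiteDimensional.mem_of_tendsto h.hasSum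
      (Filter.Eventually.of_forall fun s ↦ S.sum_mem fun i _ ↦ hf i)
  · rw [tsum_eq_zero_of_not_summable h]
    exact S.zero_mem

theorem norm_iteratedFDeriv_le_supSeminorm {K : TopologicalSpace.Compacts E} {i j : ℕ} (h : i ≤ j)
    (f : 𝓓_{K}(E, F)) (x : E) :
    ‖iteratedFDeriv ℝ i f x‖ ≤ ContDiffMapSupportedIn.supSeminorm ℝ E F ⊤ K j f :=
  (norm_iteratedFDeriv_apply_le_seminorm_top ℝ).trans
    (Seminorm.le_finset_sup_apply (Finset.mem_Iic.mpr h))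

theorem supSeminorm_le {K : TopologicalSpace.Compacts E} {j : ℕ} {C : ℝ} (hC : 0 ≤ C)
    (f : 𝓓_{K}(E, F)) (h : ∀ i ≤ j, ∀ x, ‖iteratedFDeriv ℝ i f x‖ ≤ C) :
    ContDiffMapSupportedIn.supSeminorm ℝ E F ⊤ K j f ≤ C :=
  Seminorm.finset_sup_apply_le hC fun i hi ↦
    (ContDiffMapSupportedIn.seminorm_top_le_iff ℝ hC i f).mpr
      fun x _ ↦ h i (Finset.mem_Iic.mp hi) x

/-- The value at a point of the series `∑ c n • S n` of functions, for absolutely summable `c`. -/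
theorem exists_clm_tsum [CompleteSpace F] {ι : Type*} (v : ι → F) {B : ℝ} (hB : ∀ n, ‖v n‖ ≤ B) :
    ∃ φ : lp (fun _ : ι ↦ ℝ) 1 →L[ℝ] F, ∀ c, φ c = ∑' n, c n • v n := by
  have hs : ∀ c : lp (fun _ : ι ↦ ℝ) 1, HasSum (fun n ↦ ‖c n‖) ‖c‖ := by
    intro c
    simpa using lp.hasSum_norm (p := 1) (by simp) c
  have hb : ∀ (c : lp (fun _ : ι ↦ ℝ) 1) n, ‖c n • v n‖ ≤ ‖c n‖ * B := fun c n ↦ by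
    rw [norm_smul]
    exact mul_le_mul_of_nonneg_left (hB n) (norm_nonneg _)
  have hsum : ∀ c : lp (fun _ : ι ↦ ℝ) 1, Summable fun n ↦ c n • v n := fun c ↦
    Summable.of_norm_bounded ((hs c).summable.mul_right B) (hb c)
  let L : lp (fun _ : ι ↦ ℝ) 1 →ₗ[ℝ] F :=
    { toFun := fun c ↦ ∑' n, c n • v n
      map_add' := fun c d ↦ by
        rw [← (hsum c).tsum_add (hsum d)]
        exact tsum_congr fun n ↦ add_smul _ _ _
      map_smul' := fun r c ↦ by
        rw [RingHom.id_apply, ← (hsum c).tsum_const_smul]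
        exact tsum_congr fun n ↦ mul_smul _ _ _ }
  refine ⟨L.mkContinuous B fun c ↦ ?_, fun c ↦ rfl⟩
  refine (tsum_of_norm_bounded ((hs c).mul_right B) (hb c)).trans (le_of_eq (mul_comm _ _))

/-- Let every smooth function `E → F` with support in `K` and values in the family `D` of subspaces
be a combination of the functions `σ a`, with smooth coefficients supported in `K'`. Then the
coefficients of a rapidly decreasing family of such functions can be chosen to be rapidly
decreasing. -/
theorem exists_rapid_lift [FiniteDimensional ℝ F] {N : ℕ} {σ : Fin N → E → F}
    {K K' : TopologicalSpace.Compacts E}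
    {D : E → Submodule ℝ F}
    (hlift : ∀ s : E → F, ContDiff ℝ ∞ s → Function.support s ⊆ K → (∀ x, s x ∈ D x) →
      ∃ f : 𝓓_{K'}(E, Fin N → ℝ), ∀ x, s x = ∑ a, f x a • σ a x)
    {ι : Type*} (w : ι → ℝ) (hw : ∀ n, 1 ≤ w n) (hfin : ∀ C, {n | w n ≤ C}.Finite)
    {s : ι → E → F} (hs : ∀ n, ContDiff ℝ ∞ (s n)) (hsK : ∀ n, Function.support (s n) ⊆ K)
    (hsD : ∀ n x, s n x ∈ D x)
    (hrapid : ∀ j q : ℕ, ∃ C, ∀ n x, w n ^ q * ‖iteratedFDeriv ℝ j (s n) x‖ ≤ C) :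
    ∃ f : ι → 𝓓_{K'}(E, Fin N → ℝ), (∀ n x, s n x = ∑ a, f n x a • σ a x) ∧
      ∀ j q : ℕ, ∃ C, ∀ n x, w n ^ q * ‖iteratedFDeriv ℝ j (f n) x‖ ≤ C := by
  obtain ⟨a, ha, haB, haw⟩ := exists_rapid_weight w hw
    (fun j n x ↦ ‖iteratedFDeriv ℝ j (s n) x‖) hrapid
  choose B hB using haB
  let S : ι → E → F := fun n ↦ a n • s n
  have hS : ∀ n, ContDiff ℝ ∞ (S n) := fun n ↦ (hs n).const_smul (a n)
  have hSB : ∀ j n x, ‖iteratedFDeriv ℝ j (S n) x‖ ≤ B j := by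
    intro j n x
    have : iteratedFDeriv ℝ j (S n) x = a n • iteratedFDeriv ℝ j (s n) x :=
      iteratedFDeriv_const_smul_apply' ((hs n).of_le (mod_cast le_top)).contDiffAt
    rw [this, norm_smul, Real.norm_of_nonneg (ha n).le]
    exact hB j n x
  choose φ hφ using fun x ↦ exists_clm_tsum (fun n ↦ S n x) (B := B 0)
    fun n ↦ by simpa using hSB 0 n x
  have hφs : ∀ c : lp (fun _ : ι ↦ ℝ) 1, ContDiff ℝ ∞ fun x ↦ φ x c := by
    intro c
    simp_rw [hφ]
    have hc : Summable fun n ↦ ‖c n‖ := by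
      simpa using (lp.hasSum_norm (p := 1) (by simp) c).summable
    refine contDiff_tsum (v := fun j n ↦ ‖c n‖ * B j) (fun n ↦ (hS n).const_smul (c n))
      (fun j _ ↦ hc.mul_right _) fun j n x _ ↦ ?_
    have : iteratedFDeriv ℝ j (fun x ↦ c n • S n x) x = c n • iteratedFDeriv ℝ j (S n) x :=
      iteratedFDeriv_const_smul_apply' ((hS n).of_le (mod_cast le_top)).contDiffAt
    rw [this, norm_smul]
    exact mul_le_mul_of_nonneg_left (hSB j n x) (norm_nonneg _)
  have hφK : ∀ c : lp (fun _ : ι ↦ ℝ) 1, Function.support (fun x ↦ φ x c) ⊆ K := by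
    intro c x hx
    by_contra hxK
    refine hx ?_
    change φ x c = 0
    rw [hφ]
    have : ∀ n, s n x = 0 := fun n ↦ by
      by_contra h
      exact hxK (hsK n h)
    simp [S, this]
  have hφD : ∀ (c : lp (fun _ : ι ↦ ℝ) 1) x, φ x c ∈ D x := by
    intro c x
    rw [hφ]
    exact tsum_mem_submodule _ fun n ↦
      (D x).smul_mem _ ((D x).smul_mem _ (hsD n x))
  let T : E → (Fin N → ℝ) →ₗ[ℝ] F := fun x ↦ Fintype.linearCombination ℝ fun a ↦ σ a x
  have hT : ∀ x c, T x c = ∑ a, c a • σ a x := fun x c ↦ rfl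
  let R : Submodule ℝ (lp (fun _ : ι ↦ ℝ) 1 × 𝓓_{K'}(E, Fin N → ℝ)) :=
    { carrier := {z | ∀ x, φ x z.1 = T x (z.2 x)}
      add_mem' := fun {z z'} hz hz' x ↦ by
        change φ x (z.1 + z'.1) = T x (z.2 x + z'.2 x)
        rw [map_add, map_add, hz x, hz' x]
      zero_mem' := fun x ↦ by
        change φ x 0 = T x 0
        rw [map_zero, map_zero]
      smul_mem' := fun r z hz x ↦ by
        change φ x (r • z.1) = T x (r • z.2 x)
        rw [map_smul, map_smul, hz x] }
  let p : ℕ → Seminorm ℝ 𝓓_{K'}(E, Fin N → ℝ) :=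
    ContDiffMapSupportedIn.supSeminorm ℝ E (Fin N → ℝ) ⊤ K'
  have hpmono : Monotone p := fun i j h ↦ Finset.sup_mono (Finset.Iic_subset_Iic.mpr h)
  have hsurj : ∀ c, ∃ f, (c, f) ∈ R := by
    intro c
    obtain ⟨f, hf⟩ := hlift _ (hφs c) (hφK c) (hφD c)
    exact ⟨f, hf⟩
  have hgeom : Summable fun i : ℕ ↦ ((1 : ℝ) / 2) ^ i := summable_geometric_two
  have hsum : ∀ (j : ℕ) (c : ℕ → lp (fun _ : ι ↦ ℝ) 1) (f : ℕ → 𝓓_{K'}(E, Fin N → ℝ)) (y),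
      (∀ i, (c i, f i) ∈ R) → HasSum c y →
      (∀ i, p (j + i) (f i) ≤ (1 / 2) ^ i) → ∃ g, (y, g) ∈ R ∧ p j g ≤ 2 := by
    intro j c f y hcf hc hf
    have hfb : ∀ i k, k ≤ j + i → ∀ x, ‖iteratedFDeriv ℝ k (f i) x‖ ≤ (1 / 2) ^ i :=
      fun i k hk x ↦ (norm_iteratedFDeriv_le_supSeminorm hk (f i) x).trans (hf i)
    have hg : ContDiff ℝ ∞ fun x ↦ ∑' i, f i x := by
      refine contDiff_tsum_of_eventually (N := ⊤) (v := fun _ i ↦ (1 / 2) ^ i)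
        (fun i ↦ (f i).contDiff) (fun k _ ↦ hgeom) fun k _ ↦ ?_
      rw [Nat.cofinite_eq_atTop]
      filter_upwards [Filter.eventually_ge_atTop k] with i hi
      exact hfb i k (by omega)
    have hgK : Function.support (fun x ↦ ∑' i, f i x) ⊆ K' := by
      intro x hx
      by_contra hxK
      refine hx ?_
      change ∑' i, f i x = 0
      simp [fun i ↦ (f i).zero_on_compl hxK]
    refine ⟨ContDiffMapSupportedIn.of_support_subset hg hgK, fun x ↦ ?_, ?_⟩
    · have h1 : HasSum (fun i ↦ φ x (c i)) (φ x y) := (φ x).hasSum hc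
      have hsx : Summable fun i ↦ f i x :=
        Summable.of_norm_bounded hgeom fun i ↦ by simpa using hfb i 0 (by omega) x
      have h2 : HasSum (fun i ↦ T x (f i x)) (T x (∑' i, f i x)) :=
        (LinearMap.toContinuousLinearMap (T x)).hasSum hsx.hasSum
      have h3 : (fun i ↦ φ x (c i)) = fun i ↦ T x (f i x) := funext fun i ↦ hcf i x
      rw [h3] at h1
      exact h1.unique h2
    · refine supSeminorm_le two_pos.le _ fun k hk x ↦ ?_
      have h1 := iteratedFDeriv_tsum_apply (𝕜 := ℝ) (N := (j : ℕ∞)) (f := fun i x ↦ f i x)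
        (v := fun _ i ↦ (1 / 2) ^ i)
        (fun i ↦ (f i).contDiff.of_le (mod_cast le_top)) (fun k _ ↦ hgeom)
        (fun k i x hk ↦ hfb i k (by have : k ≤ j := mod_cast hk; omega) x) (k := k)
        (mod_cast hk) x
      change ‖iteratedFDeriv ℝ k (fun y ↦ ∑' i, f i y) x‖ ≤ 2
      rw [h1]
      exact tsum_of_norm_bounded hasSum_geometric_two fun i ↦ hfb i k (by omega) x
  have hbdd := exists_bounded_lift p R hsurj hsum
  classical
  obtain ⟨f, hfR, hfp⟩ := exists_lift_forall_seminorm_le w hw hfin p hpmono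
    (fun n f ↦ ∀ x, S n x = T x (f x)) (fun j ↦ by
      obtain ⟨C, hC⟩ := hbdd j
      refine ⟨C, fun n ↦ ?_⟩
      obtain ⟨g, hg, hgC⟩ := hC (lp.single 1 n (1 : ℝ))
      rw [lp.norm_single (by simp), norm_one, mul_one] at hgC
      refine ⟨g, fun x ↦ ?_, hgC⟩
      rw [← hg x, hφ, tsum_eq_single n fun m hm ↦ by
        rw [lp.single_apply_ne _ _ _ hm, zero_smul]]
      rw [lp.single_apply_self, one_smul])
  refine ⟨fun n ↦ (a n)⁻¹ • f n, fun n x ↦ ?_, fun j q ↦ ?_⟩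
  · rw [← hT]
    change s n x = T x ((a n)⁻¹ • f n x)
    rw [map_smul, ← hfR]
    simp [S, smul_smul, inv_mul_cancel₀ (ha n).ne']
  · obtain ⟨C, hC⟩ := hfp j
    obtain ⟨A, hA⟩ := haw (q + 1)
    refine ⟨A * |C|, fun n x ↦ ?_⟩
    have h1 : iteratedFDeriv ℝ j (⇑((a n)⁻¹ • f n)) x = (a n)⁻¹ • iteratedFDeriv ℝ j (f n) x := by
      change iteratedFDeriv ℝ j (fun x ↦ (a n)⁻¹ • f n x) x = _
      exact iteratedFDeriv_const_smul_apply' ((f n).contDiff.of_le (mod_cast le_top)).contDiffAt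
    have h2 : ‖iteratedFDeriv ℝ j (f n) x‖ ≤ |C| * w n :=
      (norm_iteratedFDeriv_le_supSeminorm le_rfl (f n) x).trans ((hC n).trans
        (mul_le_mul_of_nonneg_right (le_abs_self C) (zero_le_one.trans (hw n))))
    have hw0 : 0 ≤ w n := zero_le_one.trans (hw n)
    rw [h1, norm_smul, norm_inv, Real.norm_of_nonneg (ha n).le]
    have ha' := inv_nonneg.mpr (ha n).le
    calc w n ^ q * ((a n)⁻¹ * ‖iteratedFDeriv ℝ j (f n) x‖)
        ≤ w n ^ q * ((a n)⁻¹ * (|C| * w n)) := by gcongr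
      _ = w n ^ (q + 1) * ((a n)⁻¹ * |C|) := by ring
      _ ≤ (A * a n) * ((a n)⁻¹ * |C|) := by
          gcongr
          exact hA n
      _ = A * |C| := by
          rw [mul_assoc, ← mul_assoc (a n), mul_inv_cancel₀ (ha n).ne', one_mul]

end RapidLift

/-! ### Fourier series in one of the variables -/

section PartialFourier

open MeasureTheory

/-- The partial integral `x ↦ ∫ ψ(y) s(x, y) dy`. -/
def partialIntegral {E G : Type*} [NormedAddCommGroup G] [NormedSpace ℝ G]
    (ψ : ℝ → ℝ) (s : E × ℝ → G) (x : E) : G :=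
  ∫ y, ψ y • s (x, y)

theorem exists_abs_snd_le {E G : Type*} [NormedAddCommGroup E] [NormedAddCommGroup G]
    {s : E × ℝ → G} (hc : HasCompactSupport s) :
    ∃ R : ℝ, 0 < R ∧ ∀ x y, R < |y| → s (x, y) = 0 := by
  obtain ⟨R, hR⟩ := (hc.isCompact.image continuous_snd).isBounded.subset_closedBall 0
  refine ⟨max R 1, by positivity, fun x y hy ↦ ?_⟩
  by_contra h
  have h1 : y ∈ Metric.closedBall (0 : ℝ) R := hR ⟨(x, y), subset_tsupport _ h, rfl⟩
  rw [mem_closedBall_zero_iff, Real.norm_eq_abs] at h1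
  exact absurd (h1.trans (le_max_left _ _)) (not_le.mpr hy)

theorem integrable_partial {E G : Type*} [NormedAddCommGroup E] [NormedAddCommGroup G]
    [NormedSpace ℝ G] {ψ : ℝ → ℝ} (hψ : Continuous ψ) {s : E × ℝ → G} (hs : Continuous s)
    (hc : HasCompactSupport s) (x : E) : Integrable fun y ↦ ψ y • s (x, y) := by
  have h1 : Continuous fun y ↦ ψ y • s (x, y) := by fun_prop
  refine h1.integrable_of_hasCompactSupport ?_
  obtain ⟨R, -, hR⟩ := exists_abs_snd_le hc
  refine HasCompactSupport.intro (isCompact_Icc (a := -R) (b := R)) fun y hy ↦ ?_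
  rw [hR x y, smul_zero]
  by_contra h
  exact hy (abs_le.mp (not_lt.mp h))

theorem norm_partialIntegral_le {E G : Type*} [NormedAddCommGroup G] [NormedSpace ℝ G]
    {ψ : ℝ → ℝ} (hψ : ∀ y, |ψ y| ≤ 1) {s : E × ℝ → G} {R C : ℝ} (hR0 : 0 < R)
    (hR : ∀ x y, R < |y| → s (x, y) = 0) (hC : ∀ z, ‖s z‖ ≤ C) (x : E) :
    ‖partialIntegral ψ s x‖ ≤ C * (2 * R) := by
  have h1 : partialIntegral ψ s x = ∫ y in Set.Icc (-R) R, ψ y • s (x, y) := by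
    refine (setIntegral_eq_integral_of_forall_compl_eq_zero fun y hy ↦ ?_).symm
    rw [hR x y, smul_zero]
    by_contra h
    exact hy (abs_le.mp (not_lt.mp h))
  rw [h1]
  refine (norm_setIntegral_le_of_norm_le_const (C := C) (by simp) fun y _ ↦ ?_).trans ?_
  · rw [norm_smul, Real.norm_eq_abs]
    exact (mul_le_of_le_one_left (norm_nonneg _) (hψ y)).trans (hC _)
  · have : volume.real (Set.Icc (-R) R) = 2 * R := by
      rw [Real.volume_real_Icc_of_le (by linarith)]; ring
    rw [this]

theorem partialIntegral_mem {E G : Type*} [NormedAddCommGroup E] [NormedAddCommGroup G]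
    [NormedSpace ℝ G]
    [FiniteDimensional ℝ G] {ψ : ℝ → ℝ} (hψ : Continuous ψ) {s : E × ℝ → G} (hs : Continuous s)
    (hc : HasCompactSupport s) {x : E} {S : Submodule ℝ G} (h : ∀ y, s (x, y) ∈ S) :
    partialIntegral ψ s x ∈ S := by
  have h1 : Continuous fun y ↦ ψ y • (⟨s (x, y), h y⟩ : S) := by fun_prop
  obtain ⟨R, -, hR⟩ := exists_abs_snd_le hc
  have h2 : Integrable fun y ↦ ψ y • (⟨s (x, y), h y⟩ : S) := by
    refine h1.integrable_of_hasCompactSupport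
      (HasCompactSupport.intro (isCompact_Icc (a := -R) (b := R)) fun y hy ↦ ?_)
    refine Subtype.ext ?_
    change ψ y • s (x, y) = 0
    rw [hR x y, smul_zero]
    by_contra h
    exact hy (abs_le.mp (not_lt.mp h))
  have h3 := S.subtypeL.integral_comp_comm h2
  have h4 : partialIntegral ψ s x = S.subtypeL (∫ y, ψ y • (⟨s (x, y), h y⟩ : S)) := by
    rw [← h3]; rfl
  rw [h4]
  exact Subtype.mem _

variable {E : Type} [NormedAddCommGroup E] [NormedSpace ℝ E]

/-- The partial derivative in the first variable. -/
def fderivFst {G : Type*} [NormedAddCommGroup G] [NormedSpace ℝ G] (s : E × ℝ → G) :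
    E × ℝ → E →L[ℝ] G :=
  fun z ↦ (fderiv ℝ s z).comp (ContinuousLinearMap.inl ℝ E ℝ)

/-- The partial derivative in the second variable. -/
def derivSnd {G : Type*} [NormedAddCommGroup G] [NormedSpace ℝ G] (s : E × ℝ → G) :
    E × ℝ → G :=
  fun z ↦ fderiv ℝ s z (0, 1)

theorem contDiff_fderivFst {G : Type*} [NormedAddCommGroup G] [NormedSpace ℝ G] {s : E × ℝ → G}
    (hs : ContDiff ℝ ∞ s) : ContDiff ℝ ∞ (fderivFst s) :=
  (hs.fderiv_right (m := ∞) (by simp)).clm_comp contDiff_const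

theorem contDiff_derivSnd {G : Type*} [NormedAddCommGroup G] [NormedSpace ℝ G] {s : E × ℝ → G}
    (hs : ContDiff ℝ ∞ s) : ContDiff ℝ ∞ (derivSnd s) :=
  (hs.fderiv_right (m := ∞) (by simp)).clm_apply contDiff_const

theorem hasCompactSupport_fderivFst {G : Type*} [NormedAddCommGroup G] [NormedSpace ℝ G]
    {s : E × ℝ → G} (hc : HasCompactSupport s) : HasCompactSupport (fderivFst s) :=
  (hc.fderiv (𝕜 := ℝ)).comp_left
    (g := fun L : E × ℝ →L[ℝ] G ↦ L.comp (ContinuousLinearMap.inl ℝ E ℝ)) (by simp)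

theorem hasCompactSupport_derivSnd {G : Type*} [NormedAddCommGroup G] [NormedSpace ℝ G]
    {s : E × ℝ → G} (hc : HasCompactSupport s) : HasCompactSupport (derivSnd s) :=
  (hc.fderiv (𝕜 := ℝ)).comp_left (g := fun L : E × ℝ →L[ℝ] G ↦ L (0, 1)) (by simp)

theorem hasFDerivAt_partialIntegral {G : Type*} [NormedAddCommGroup G] [NormedSpace ℝ G]
    {ψ : ℝ → ℝ} (hψ : Continuous ψ) (hψ1 : ∀ y, |ψ y| ≤ 1) {s : E × ℝ → G}
    (hs : ContDiff ℝ ∞ s) (hc : HasCompactSupport s) (x : E) :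
    HasFDerivAt (partialIntegral ψ s) (partialIntegral ψ (fderivFst s) x) x := by
  have hs' := contDiff_fderivFst hs
  have hc' := hasCompactSupport_fderivFst hc
  obtain ⟨R, -, hR⟩ := exists_abs_snd_le hc'
  obtain ⟨C, hC⟩ := hs'.continuous.bounded_above_of_compact_support hc'
  refine hasFDerivAt_integral_of_dominated_of_fderiv_le
    (bound := (Set.Icc (-R) R).indicator fun _ ↦ C)
    (F' := fun x y ↦ ψ y • fderivFst s (x, y)) Filter.univ_mem
    (Filter.Eventually.of_forall fun x ↦
      (integrable_partial hψ hs.continuous hc x).aestronglyMeasurable)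
    (integrable_partial hψ hs.continuous hc x)
    (integrable_partial hψ hs'.continuous hc' x).aestronglyMeasurable
    (Filter.Eventually.of_forall fun y x _ ↦ ?_) ?_
    (Filter.Eventually.of_forall fun y x _ ↦ ?_)
  · by_cases hy : y ∈ Set.Icc (-R) R
    · rw [Set.indicator_of_mem hy, norm_smul, Real.norm_eq_abs]
      exact (mul_le_of_le_one_left (norm_nonneg _) (hψ1 y)).trans (hC _)
    · rw [Set.indicator_of_notMem hy, hR x y, smul_zero, norm_zero]
      by_contra h
      exact hy (abs_le.mp (not_lt.mp h))
  · exact (integrable_indicator_iff measurableSet_Icc).mpr (by simp)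
  · have h1 : HasFDerivAt s (fderiv ℝ s (x, y)) (x, y) :=
      (hs.differentiable (by simp)).differentiableAt.hasFDerivAt
    have h2 : HasFDerivAt (fun x : E ↦ (x, y)) (ContinuousLinearMap.inl ℝ E ℝ) x :=
      hasFDerivAt_prodMk_left x y
    exact (h1.comp x h2).const_smul (ψ y)

theorem fderiv_partialIntegral {G : Type*} [NormedAddCommGroup G] [NormedSpace ℝ G]
    {ψ : ℝ → ℝ} (hψ : Continuous ψ) (hψ1 : ∀ y, |ψ y| ≤ 1) {s : E × ℝ → G}
    (hs : ContDiff ℝ ∞ s) (hc : HasCompactSupport s) :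
    fderiv ℝ (partialIntegral ψ s) = partialIntegral ψ (fderivFst s) :=
  funext fun x ↦ (hasFDerivAt_partialIntegral hψ hψ1 hs hc x).fderiv

theorem contDiff_partialIntegral {G : Type*} [NormedAddCommGroup G] [NormedSpace ℝ G]
    {ψ : ℝ → ℝ} (hψ : Continuous ψ) (hψ1 : ∀ y, |ψ y| ≤ 1) {s : E × ℝ → G}
    (hs : ContDiff ℝ ∞ s) (hc : HasCompactSupport s) :
    ContDiff ℝ ∞ (partialIntegral ψ s) := by
  refine contDiff_infty.mpr fun k ↦ ?_
  induction k generalizing G with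
  | zero =>
    exact contDiff_zero.mpr (continuous_iff_continuousAt.mpr fun x ↦
      (hasFDerivAt_partialIntegral hψ hψ1 hs hc x).continuousAt)
  | succ k ih =>
    rw [Nat.cast_add, Nat.cast_one, contDiff_succ_iff_fderiv]
    refine ⟨fun x ↦ (hasFDerivAt_partialIntegral hψ hψ1 hs hc x).differentiableAt, by simp, ?_⟩
    rw [fderiv_partialIntegral hψ hψ1 hs hc]
    exact ih (contDiff_fderivFst hs) (hasCompactSupport_fderivFst hc)

theorem exists_norm_iteratedFDeriv_partialIntegral_le {G : Type*} [NormedAddCommGroup G]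
    [NormedSpace ℝ G] {s : E × ℝ → G} (hs : ContDiff ℝ ∞ s) (hc : HasCompactSupport s) (j : ℕ) :
    ∃ C, ∀ ψ : ℝ → ℝ, Continuous ψ → (∀ y, |ψ y| ≤ 1) →
      ∀ x, ‖iteratedFDeriv ℝ j (partialIntegral ψ s) x‖ ≤ C := by
  induction j generalizing G with
  | zero =>
    obtain ⟨R, hR0, hR⟩ := exists_abs_snd_le hc
    obtain ⟨C, hC⟩ := hs.continuous.bounded_above_of_compact_support hc
    refine ⟨C * (2 * R), fun ψ _ hψ1 x ↦ ?_⟩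
    rw [norm_iteratedFDeriv_zero]
    exact norm_partialIntegral_le hψ1 hR0 hR hC x
  | succ j ih =>
    obtain ⟨C, hC⟩ := ih (contDiff_fderivFst hs) (hasCompactSupport_fderivFst hc)
    refine ⟨C, fun ψ hψ hψ1 x ↦ ?_⟩
    rw [← norm_iteratedFDeriv_fderiv, fderiv_partialIntegral hψ hψ1 hs hc]
    exact hC ψ hψ hψ1 x

/-- Integration by parts. -/
theorem smul_partialIntegral_cos {G : Type*} [NormedAddCommGroup G] [NormedSpace ℝ G]
    [CompleteSpace G] {s : E × ℝ → G} (hs : ContDiff ℝ ∞ s) (hc : HasCompactSupport s)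
    (c θ : ℝ) (x : E) :
    c • partialIntegral (fun y ↦ Real.cos (c * y + θ)) s x =
      -partialIntegral (fun y ↦ Real.cos (c * y + (θ - Real.pi / 2))) (derivSnd s) x := by
  have h1 : ∀ y : ℝ, HasDerivAt (fun y ↦ Real.sin (c * y + θ) • s (x, y))
      (Real.sin (c * y + θ) • derivSnd s (x, y) + (Real.cos (c * y + θ) * c) • s (x, y)) y := by
    intro y
    have h2 : HasDerivAt (fun y ↦ Real.sin (c * y + θ)) (Real.cos (c * y + θ) * c) y := by
      have : HasDerivAt (fun y ↦ c * y + θ) c y := by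
        simpa using ((hasDerivAt_id y).const_mul c).add_const θ
      exact this.sin
    have h3 : HasDerivAt (fun y ↦ s (x, y)) (derivSnd s (x, y)) y := by
      have h4 : HasFDerivAt s (fderiv ℝ s (x, y)) (x, y) :=
        (hs.differentiable (by simp)).differentiableAt.hasFDerivAt
      exact h4.comp_hasDerivAt y ((hasDerivAt_const y x).prodMk (hasDerivAt_id y))
    exact h2.smul h3
  have hi1 : Integrable fun y ↦ Real.sin (c * y + θ) • derivSnd s (x, y) :=
    integrable_partial (ψ := fun y ↦ Real.sin (c * y + θ)) (by fun_prop)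
      (contDiff_derivSnd hs).continuous (hasCompactSupport_derivSnd hc) x
  have hi2 : Integrable fun y ↦ (Real.cos (c * y + θ) * c) • s (x, y) :=
    integrable_partial (ψ := fun y ↦ Real.cos (c * y + θ) * c) (by fun_prop) hs.continuous hc x
  have hi3 : Integrable fun y ↦ Real.sin (c * y + θ) • s (x, y) :=
    integrable_partial (ψ := fun y ↦ Real.sin (c * y + θ)) (by fun_prop) hs.continuous hc x
  have h0 := integral_eq_zero_of_hasDerivAt_of_integrable h1 (hi1.add hi2) hi3
  rw [integral_add hi1 hi2] at h0
  have h5 : c • partialIntegral (fun y ↦ Real.cos (c * y + θ)) s x =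
      ∫ y, (Real.cos (c * y + θ) * c) • s (x, y) := by
    rw [partialIntegral, ← integral_smul]
    exact integral_congr_ae (Filter.Eventually.of_forall fun y ↦ by
      simp only [smul_smul]; rw [mul_comm])
  have h6 : ∀ y, Real.cos (c * y + (θ - Real.pi / 2)) = Real.sin (c * y + θ) := fun y ↦ by
    rw [← add_sub_assoc, Real.cos_sub_pi_div_two]
  rw [h5, partialIntegral]
  simp_rw [h6]
  exact eq_neg_of_add_eq_zero_right h0

/-- The partial Fourier coefficients of a smooth function with compact support are rapidly
decreasing, together with all their derivatives. -/
theorem exists_rapid_partialIntegral {G : Type*} [NormedAddCommGroup G] [NormedSpace ℝ G]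
    [CompleteSpace G] {ν : ℝ} (hν : 0 < ν) (j q : ℕ) {s : E × ℝ → G} (hs : ContDiff ℝ ∞ s)
    (hc : HasCompactSupport s) :
    ∃ C, ∀ (n : ℤ) (θ : ℝ) (x : E), (1 + |(n : ℝ)|) ^ q *
      ‖iteratedFDeriv ℝ j (partialIntegral (fun y ↦ Real.cos (ν * n * y + θ)) s) x‖ ≤ C := by
  have hcos : ∀ c θ : ℝ, Continuous fun y ↦ Real.cos (c * y + θ) := fun c θ ↦ by fun_prop
  have hcos1 : ∀ c θ y : ℝ, |Real.cos (c * y + θ)| ≤ 1 := fun c θ y ↦ Real.abs_cos_le_one _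
  induction q generalizing s with
  | zero =>
    obtain ⟨C, hC⟩ := exists_norm_iteratedFDeriv_partialIntegral_le hs hc j
    exact ⟨C, fun n θ x ↦ by simpa using hC _ (hcos _ θ) (hcos1 _ θ) x⟩
  | succ q ih =>
    obtain ⟨C, hC⟩ := ih hs hc
    obtain ⟨C', hC'⟩ := ih (contDiff_derivSnd hs) (hasCompactSupport_derivSnd hc)
    refine ⟨C + ν⁻¹ * C', fun n θ x ↦ ?_⟩
    have h1 := hC n θ x
    have h2 := hC' n (θ - Real.pi / 2) x
    have h3 : |ν * (n : ℝ)| *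
        ‖iteratedFDeriv ℝ j (partialIntegral (fun y ↦ Real.cos (ν * n * y + θ)) s) x‖ =
        ‖iteratedFDeriv ℝ j (partialIntegral
          (fun y ↦ Real.cos (ν * n * y + (θ - Real.pi / 2))) (derivSnd s)) x‖ := by
      have h4 : (fun x ↦ (ν * n : ℝ) • partialIntegral (fun y ↦ Real.cos (ν * n * y + θ)) s x) =
          -partialIntegral (fun y ↦ Real.cos (ν * n * y + (θ - Real.pi / 2))) (derivSnd s) :=
        funext fun x ↦ smul_partialIntegral_cos hs hc _ θ x
      have h5 : ContDiff ℝ ∞ (partialIntegral (fun y ↦ Real.cos (ν * n * y + θ)) s) :=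
        contDiff_partialIntegral (hcos _ θ) (hcos1 _ θ) hs hc
      rw [← norm_neg (iteratedFDeriv ℝ j (partialIntegral
        (fun y ↦ Real.cos (ν * n * y + (θ - Real.pi / 2))) (derivSnd s)) x),
        ← iteratedFDeriv_neg_apply, ← h4, iteratedFDeriv_const_smul_apply'
        (h5.of_le (mod_cast le_top)).contDiffAt, norm_smul, Real.norm_eq_abs]
    rw [abs_mul, abs_of_pos hν] at h3
    have h6 : |(n : ℝ)| *
        ‖iteratedFDeriv ℝ j (partialIntegral (fun y ↦ Real.cos (ν * n * y + θ)) s) x‖ =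
        ν⁻¹ * ‖iteratedFDeriv ℝ j (partialIntegral
          (fun y ↦ Real.cos (ν * n * y + (θ - Real.pi / 2))) (derivSnd s)) x‖ := by
      rw [← h3, mul_assoc, inv_mul_cancel_left₀ hν.ne']
    have h7 : 0 < ν⁻¹ := inv_pos.mpr hν
    rw [pow_succ, mul_assoc, add_mul, one_mul, mul_add, h6]
    refine add_le_add h1 ?_
    calc _ = ν⁻¹ * _ := mul_left_comm _ _ _
      _ ≤ ν⁻¹ * C' := mul_le_mul_of_nonneg_left h2 h7.le

/-- The Fourier series of a real function with small support, in real form. -/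
theorem hasSum_cos_add_sin {h : ℝ → ℝ} (hh : Continuous h) {R T : ℝ} (hT : T = 2 * R)
    (hR0 : 0 < R) (hR : ∀ y, R ≤ |y| → h y = 0)
    (hs1 : Summable fun n : ℤ ↦ ∫ z, Real.cos (2 * Real.pi / T * n * z) * h z)
    (hs2 : Summable fun n : ℤ ↦ ∫ z, Real.sin (2 * Real.pi / T * n * z) * h z)
    {y : ℝ} (hy : |y| ≤ R) :
    HasSum (fun n : ℤ ↦ T⁻¹ *
      (Real.cos (2 * Real.pi / T * n * y) * (∫ z, Real.cos (2 * Real.pi / T * n * z) * h z) +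
        Real.sin (2 * Real.pi / T * n * y) * ∫ z, Real.sin (2 * Real.pi / T * n * z) * h z))
      (h y) := by
  have hTpos : 0 < T := by rw [hT]; positivity
  have : Fact (0 < T) := ⟨hTpos⟩
  have hab : -R + T = R := by rw [hT]; ring
  let H : ℝ → ℂ := fun y ↦ (h y : ℂ)
  have hH : Continuous H := Complex.continuous_ofReal.comp hh
  have hcont : Continuous (AddCircle.liftIco T (-R) H) := by
    refine AddCircle.liftIco_continuous ?_ hH.continuousOn
    simp only [H]
    rw [hab, hR (-R) (by rw [abs_neg, abs_of_pos hR0]), hR R (by rw [abs_of_pos hR0])]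
  let f : C(AddCircle T, ℂ) := ⟨_, hcont⟩
  have hint : ∀ g : ℝ → ℝ, Continuous g → Integrable fun z ↦ g z * h z := fun g hg ↦
    (hg.mul hh).integrable_of_hasCompactSupport
      (HasCompactSupport.intro (isCompact_Icc (a := -R) (b := R)) fun y hy ↦ by
        rw [Pi.mul_apply, hR y, mul_zero]
        by_contra h
        exact hy (abs_le.mp (not_le.mp h).le))
  have hcoef : ∀ n : ℤ, fourierCoeff f n = (T⁻¹ : ℝ) *
      ((∫ z, Real.cos (2 * Real.pi / T * n * z) * h z : ℝ) -
        (∫ z, Real.sin (2 * Real.pi / T * n * z) * h z : ℝ) * Complex.I) := by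
    intro n
    have h1 : fourierCoeff f n =
        (1 / T) • ∫ z in -R..(-R + T), fourier (-n) (z : AddCircle T) • H z := by
      have h0 : fourierCoeff f n = fourierCoeffOn (lt_add_of_pos_right (-R) hTpos) H n :=
        fourierCoeff_liftIco_eq H n
      rw [h0, fourierCoeffOn_eq_integral, add_sub_cancel_left]
    have h2 : ∀ z : ℝ, fourier (-n) (z : AddCircle T) • H z =
        ((Real.cos (2 * Real.pi / T * n * z) * h z : ℝ) : ℂ) -
          ((Real.sin (2 * Real.pi / T * n * z) * h z : ℝ) : ℂ) * Complex.I := by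
      intro z
      have h3 : fourier (-n) (z : AddCircle T) =
          Complex.exp (((-(2 * Real.pi / T * n * z) : ℝ) : ℂ) * Complex.I) := by
        rw [fourier_coe_apply]
        congr 1
        push_cast
        ring
      rw [h3, Complex.exp_mul_I, ← Complex.ofReal_cos, ← Complex.ofReal_sin, Real.cos_neg,
        Real.sin_neg, smul_eq_mul]
      simp only [H]
      push_cast
      ring
    have h3 : ∫ z in -R..(-R + T), fourier (-n) (z : AddCircle T) • H z =
        ∫ z, (((Real.cos (2 * Real.pi / T * n * z) * h z : ℝ) : ℂ) -
          ((Real.sin (2 * Real.pi / T * n * z) * h z : ℝ) : ℂ) * Complex.I) := by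
      rw [intervalIntegral.integral_of_le (by linarith), hab]
      simp_rw [h2]
      refine setIntegral_eq_integral_of_forall_compl_eq_zero fun z hz ↦ ?_
      have : h z = 0 := hR z (by
        by_contra h0
        have := abs_lt.mp (not_le.mp h0)
        exact hz ⟨this.1, this.2.le⟩)
      simp [this]
    rw [h1, h3, integral_sub ((hint _ (by fun_prop)).ofReal)
      (((hint _ (by fun_prop)).ofReal).mul_const _), integral_mul_const]
    have e : ∀ g : ℝ → ℝ, ∫ z, ((g z : ℝ) : ℂ) = ((∫ z, g z : ℝ) : ℂ) := fun g ↦ integral_ofReal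
    rw [e, e, Complex.real_smul, one_div]
  have hsum : Summable (fourierCoeff f) := by
    have : (fourierCoeff f : ℤ → ℂ) = fun n : ℤ ↦ ((T⁻¹ : ℝ) : ℂ) *
      (((∫ z, Real.cos (2 * Real.pi / T * n * z) * h z : ℝ) : ℂ) -
        ((∫ z, Real.sin (2 * Real.pi / T * n * z) * h z : ℝ) : ℂ) * Complex.I) := funext hcoef
    rw [this]
    exact ((Complex.summable_ofReal.mpr hs1).sub
      ((Complex.summable_ofReal.mpr hs2).mul_right _)).mul_left _
  have hmain : HasSum (fun n : ℤ ↦ fourierCoeff f n • fourier n (y : AddCircle T)) (H y) := by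
    have h1 := has_pointwise_sum_fourier_series_of_summable hsum (y : AddCircle T)
    have h2 : f (y : AddCircle T) = H y := by
      rcases (abs_le.mp hy).2.lt_or_eq with h3 | rfl
      · exact AddCircle.liftIco_coe_apply (f := H) (p := T) (a := -R)
          ⟨(abs_le.mp hy).1, by rwa [hab]⟩
      · have h0 : H y = H (-y) := by
          simp only [H]
          rw [hR y (le_abs_self y), hR (-y) (by rw [abs_neg]; exact le_abs_self y)]
        have h4 : ((y : ℝ) : AddCircle T) = ((-y : ℝ) : AddCircle T) := by
          conv_lhs => rw [← hab]
          simp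
        rw [h4, h0]
        exact AddCircle.liftIco_coe_apply (f := H) (p := T) (a := -y) ⟨le_rfl, by linarith⟩
    rwa [h2] at h1
  have halg : ∀ t A B c s : ℝ, (((t : ℝ) : ℂ) * ((A : ℂ) - (B : ℂ) * Complex.I) *
      ((c : ℂ) + (s : ℂ) * Complex.I)).re = t * (c * A + s * B) := by
    intro t A B c s
    simp
    ring
  convert! Complex.hasSum_re hmain using 2 with n
  have h3 : fourier n (y : AddCircle T) =
      Complex.exp (((2 * Real.pi / T * n * y : ℝ) : ℂ) * Complex.I) := by
    rw [fourier_coe_apply]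
    congr 1
    push_cast
    ring
  rw [hcoef, h3, Complex.exp_mul_I, ← Complex.ofReal_cos, ← Complex.ofReal_sin, smul_eq_mul, halg]

end PartialFourier

/-! ### Generators of modules of sections, and parameters -/

section Parameters

open MeasureTheory ContDiffMapSupportedIn Distributions

theorem summable_inv_one_add_abs_sq : Summable fun n : ℤ ↦ ((1 + |(n : ℝ)|) ^ 2)⁻¹ := by
  refine Summable.of_norm_bounded_eventually (g := fun n : ℤ ↦ 1 / (n : ℝ) ^ 2)
    (Real.summable_one_div_int_pow.mpr one_lt_two) ?_
  filter_upwards [(Set.finite_singleton (0 : ℤ)).compl_mem_cofinite] with n hn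
  have hn' : (n : ℝ) ≠ 0 := by exact_mod_cast hn
  rw [Real.norm_of_nonneg (by positivity), one_div, ← sq_abs (n : ℝ)]
  have : 0 < |(n : ℝ)| := abs_pos.mpr hn'
  gcongr
  linarith

theorem abs_iteratedDeriv_cos_le (c θ y : ℝ) (i : ℕ) :
    ‖iteratedFDeriv ℝ i (fun y ↦ Real.cos (c * y + θ)) y‖ ≤ |c| ^ i := by
  have h1 : ContDiff ℝ i fun u ↦ Real.cos (u + θ) := by fun_prop
  rw [norm_iteratedFDeriv_eq_norm_iteratedDeriv]
  have h2 := congrFun (iteratedDeriv_comp_const_mul h1 c) y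
  rw [h2, norm_mul, norm_pow, Real.norm_eq_abs]
  refine mul_le_of_le_one_right (by positivity) ?_
  rw [← norm_iteratedFDeriv_eq_norm_iteratedDeriv, iteratedFDeriv_comp_add_right,
    norm_iteratedFDeriv_eq_norm_iteratedDeriv]
  exact Real.abs_iteratedDeriv_cos_le_one i _

theorem norm_iteratedFDeriv_comp_right_le {E E' G : Type*} [NormedAddCommGroup E]
    [NormedSpace ℝ E] [NormedAddCommGroup E'] [NormedSpace ℝ E'] [NormedAddCommGroup G]
    [NormedSpace ℝ G] {f : E → G} (hf : ContDiff ℝ ∞ f) (L : E' →L[ℝ] E) (hL : ‖L‖ ≤ 1) (i : ℕ)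
    (x : E') : ‖iteratedFDeriv ℝ i (fun x ↦ f (L x)) x‖ ≤ ‖iteratedFDeriv ℝ i f (L x)‖ := by
  have h1 := L.iteratedFDeriv_comp_right hf x (i := i) (mod_cast le_top)
  have h2 : (fun x ↦ f (L x)) = f ∘ L := rfl
  rw [h2, h1]
  refine (ContinuousMultilinearMap.norm_compContinuousLinearMap_le _ _).trans ?_
  refine mul_le_of_le_one_right (norm_nonneg _) ?_
  exact Finset.prod_le_one (fun _ _ ↦ norm_nonneg _) fun _ _ ↦ hL

theorem norm_le_of_rapid {E : Type*} {g : ℤ → E → ℝ}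
    (h : ∀ q : ℕ, ∃ C, ∀ (n : ℤ) x, (1 + |(n : ℝ)|) ^ q * g n x ≤ C) (q : ℕ) :
    ∃ C, 0 ≤ C ∧ ∀ (n : ℤ) x, g n x ≤ C * ((1 + |(n : ℝ)|) ^ q)⁻¹ := by
  obtain ⟨C, hC⟩ := h q
  refine ⟨|C|, abs_nonneg C, fun n x ↦ ?_⟩
  have : (0 : ℝ) < (1 + |(n : ℝ)|) ^ q := by positivity
  rw [← div_eq_mul_inv, le_div_iff₀' this]
  exact (hC n x).trans (le_abs_self C)

section Series

variable {E W : Type*} [NormedAddCommGroup E] [NormedSpace ℝ E] [NormedAddCommGroup W]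
  [NormedSpace ℝ W] {f : ℤ → E → W}

theorem summable_cos_smul [CompleteSpace W]
    (hrapid : ∀ j q : ℕ, ∃ C, ∀ (n : ℤ) x, (1 + |(n : ℝ)|) ^ q * ‖iteratedFDeriv ℝ j (f n) x‖ ≤ C)
    (c θ : ℝ) (x : E) (y : ℝ) : Summable fun n : ℤ ↦ Real.cos (c * n * y + θ) • f n x := by
  obtain ⟨C, -, hC⟩ := norm_le_of_rapid (hrapid 0) 2
  refine Summable.of_norm_bounded (summable_inv_one_add_abs_sq.mul_left C) fun n ↦ ?_
  rw [norm_smul, Real.norm_eq_abs]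
  refine (mul_le_of_le_one_left (norm_nonneg _) (Real.abs_cos_le_one _)).trans ?_
  simpa using hC n x

/-- A trigonometric series with rapidly decreasing smooth coefficients is smooth in all
variables. -/
theorem contDiff_tsum_cos_smul [CompleteSpace W] (hf : ∀ n, ContDiff ℝ ∞ (f n))
    (hrapid : ∀ j q : ℕ, ∃ C, ∀ (n : ℤ) x, (1 + |(n : ℝ)|) ^ q * ‖iteratedFDeriv ℝ j (f n) x‖ ≤ C)
    (c θ : ℝ) :
    ContDiff ℝ ∞ fun z : E × ℝ ↦ ∑' n : ℤ, Real.cos (c * n * z.2 + θ) • f n z.1 := by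
  choose C hC0 hC using fun j q ↦ norm_le_of_rapid (hrapid j) q
  have hcos : ∀ n : ℤ, ContDiff ℝ ∞ fun y ↦ Real.cos (c * n * y + θ) := fun n ↦ by fun_prop
  refine contDiff_tsum (v := fun j (n : ℤ) ↦ (∑ i ∈ Finset.range (j + 1),
    (j.choose i : ℝ) * (1 + |c|) ^ j * C (j - i) (j + 2)) * ((1 + |(n : ℝ)|) ^ 2)⁻¹)
    (fun n ↦ ((hcos n).comp contDiff_snd).smul ((hf n).comp contDiff_fst))
    (fun j _ ↦ summable_inv_one_add_abs_sq.mul_left _) fun j n z _ ↦ ?_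
  refine (norm_iteratedFDeriv_smul_le (N := ∞) ((hcos n).comp contDiff_snd)
    ((hf n).comp contDiff_fst) z (n := j) (mod_cast le_top)).trans ?_
  rw [Finset.sum_mul]
  refine Finset.sum_le_sum fun i hi ↦ ?_
  have hi' : i ≤ j := Nat.lt_succ_iff.mp (Finset.mem_range.mp hi)
  have h1 : ‖iteratedFDeriv ℝ i ((fun y ↦ Real.cos (c * n * y + θ)) ∘ Prod.snd) z‖ ≤
      ((1 + |c|) * (1 + |(n : ℝ)|)) ^ j := by
    refine (norm_iteratedFDeriv_comp_right_le (hcos n) (ContinuousLinearMap.snd ℝ E ℝ)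
      (ContinuousLinearMap.norm_snd_le ℝ E ℝ) i z).trans
      ((abs_iteratedDeriv_cos_le _ _ _ _).trans ?_)
    have h0 : |c * n| ≤ (1 + |c|) * (1 + |(n : ℝ)|) := by
      rw [abs_mul]
      nlinarith [abs_nonneg c, abs_nonneg (n : ℝ)]
    have h1 : 1 ≤ (1 + |c|) * (1 + |(n : ℝ)|) := by nlinarith [abs_nonneg c, abs_nonneg (n : ℝ)]
    exact (pow_le_pow_left₀ (abs_nonneg _) h0 i).trans (pow_le_pow_right₀ h1 hi')
  have h2 : ‖iteratedFDeriv ℝ (j - i) ((fun x ↦ f n x) ∘ Prod.fst) z‖ ≤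
      C (j - i) (j + 2) * ((1 + |(n : ℝ)|) ^ (j + 2))⁻¹ :=
    (norm_iteratedFDeriv_comp_right_le (hf n) (ContinuousLinearMap.fst ℝ E ℝ)
      (ContinuousLinearMap.norm_fst_le ℝ E ℝ) (j - i) z).trans (hC _ _ n z.1)
  have h3 : (0 : ℝ) < 1 + |(n : ℝ)| := by positivity
  calc _ ≤ (j.choose i : ℝ) * ((1 + |c|) * (1 + |(n : ℝ)|)) ^ j *
        (C (j - i) (j + 2) * ((1 + |(n : ℝ)|) ^ (j + 2))⁻¹) := by
        gcongr
    _ = (j.choose i : ℝ) * (1 + |c|) ^ j * C (j - i) (j + 2) * ((1 + |(n : ℝ)|) ^ 2)⁻¹ := by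
        rw [mul_pow, pow_add (1 + |(n : ℝ)|) j 2]
        field_simp

end Series

/-- A smooth cutoff function on a finite-dimensional space. -/
theorem exists_cutoff {E : Type*} [NormedAddCommGroup E] [NormedSpace ℝ E]
    [FiniteDimensional ℝ E] {K U : Set E} (hK : IsCompact K) (hU : IsOpen U) (hKU : K ⊆ U) :
    ∃ (χ : E → ℝ) (K' : Set E), ContDiff ℝ ∞ χ ∧ IsCompact K' ∧ K' ⊆ U ∧ (∀ x ∈ K, χ x = 1) ∧
      ∀ x, x ∉ K' → χ x = 0 := by
  obtain ⟨K', hK', hKK', hK'U⟩ := exists_compact_between hK hU hKU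
  obtain ⟨χ, h1, h0, -⟩ := exists_contMDiffMap_one_nhds_of_subset_interior 𝓘(ℝ, E) (n := ⊤)
    hK.isClosed hKK'
  exact ⟨χ, K', χ.contMDiff.contDiff, hK', hK'U, fun x hx ↦ h1.self_of_nhdsSet x hx, h0⟩

/-- The functions `σ a` generate the smooth functions with values in the family `D` of subspaces
and compact support in `U`. -/
def GeneratesSections {E F : Type*} [NormedAddCommGroup E] [NormedSpace ℝ E]
    [NormedAddCommGroup F] [NormedSpace ℝ F] {N : ℕ} (U : Set E) (D : E → Submodule ℝ F)
    (σ : Fin N → E → F) : Prop :=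
  ∀ s : E → F, ContDiff ℝ ∞ s → HasCompactSupport s → tsupport s ⊆ U → (∀ x, s x ∈ D x) →
    ∃ f : E → Fin N → ℝ, ContDiff ℝ ∞ f ∧ ∀ x, s x = ∑ a, f x a • σ a x

theorem GeneratesSections.comp_equiv {E E' F : Type*} [NormedAddCommGroup F] [NormedSpace ℝ F]
    {N : ℕ} [NormedAddCommGroup E] [NormedSpace ℝ E]
    [NormedAddCommGroup E'] [NormedSpace ℝ E'] {U : Set E} {D : E → Submodule ℝ F}
    {σ : Fin N → E → F} (h : GeneratesSections U D σ) (e : E' ≃L[ℝ] E) :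
    GeneratesSections (e ⁻¹' U) (fun z ↦ D (e z)) fun a z ↦ σ a (e z) := by
  intro s hs hc hsU hsD
  obtain ⟨f, hf, hfs⟩ := h (s ∘ e.symm) (hs.comp e.symm.contDiff)
    (hc.comp_homeomorph e.symm.toHomeomorph) (by
      have : tsupport (s ∘ e.symm) = e.symm ⁻¹' tsupport s :=
        tsupport_comp_eq_preimage s e.symm.toHomeomorph
      rw [this]
      intro x hx
      have := hsU hx
      rwa [Set.mem_preimage, e.apply_symm_apply] at this)
    (fun x ↦ by simpa using hsD (e.symm x))
  exact ⟨f ∘ e, hf.comp e.contDiff, fun x ↦ by simpa using hfs (e x)⟩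

variable {F : Type*} [NormedAddCommGroup F] [NormedSpace ℝ F] [FiniteDimensional ℝ F] {N : ℕ}

/-- The partial Fourier series of a smooth family of functions. -/
theorem eq_tsum_partialIntegral {E : Type} [NormedAddCommGroup E] [NormedSpace ℝ E]
    {s : E × ℝ → F} (hs : ContDiff ℝ ∞ s) (hc : HasCompactSupport s) {R T ν : ℝ} (hR : 0 < R)
    (hT : T = 2 * R) (hνT : ν = 2 * Real.pi / T) (hsR : ∀ x y, R ≤ |y| → s (x, y) = 0) (x : E)
    {y : ℝ} (hy : |y| ≤ R) :
    s (x, y) = T⁻¹ • ((∑' n : ℤ, Real.cos (ν * n * y + 0) •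
        partialIntegral (fun y ↦ Real.cos (ν * n * y + 0)) s x) +
      ∑' n : ℤ, Real.cos (ν * n * y + -(Real.pi / 2)) •
        partialIntegral (fun y ↦ Real.cos (ν * n * y + -(Real.pi / 2))) s x) := by
  have hν : 0 < ν := by rw [hνT, hT]; positivity
  have hcos : ∀ c θ : ℝ, Continuous fun y ↦ Real.cos (c * y + θ) := fun c θ ↦ by fun_prop
  let A : ℝ → ℤ → E → F := fun θ n ↦ partialIntegral (fun y ↦ Real.cos (ν * n * y + θ)) s
  have hArapid : ∀ θ (j q : ℕ), ∃ C, ∀ (n : ℤ) x,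
      (1 + |(n : ℝ)|) ^ q * ‖iteratedFDeriv ℝ j (A θ n) x‖ ≤ C := by
    intro θ j q
    obtain ⟨C, hC⟩ := exists_rapid_partialIntegral hν j q hs hc
    exact ⟨C, fun n x ↦ hC n θ x⟩
  have hAsum : ∀ θ, Summable fun n : ℤ ↦ Real.cos (ν * n * y + θ) • A θ n x := fun θ ↦
    summable_cos_smul (hArapid θ) ν θ x y
  change _ = T⁻¹ • ((∑' n : ℤ, Real.cos (ν * n * y + 0) • A 0 n x) +
    ∑' n : ℤ, Real.cos (ν * n * y + -(Real.pi / 2)) • A (-(Real.pi / 2)) n x)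
  refine (SeparatingDual.eq_iff_forall_dual_eq (R := ℝ)).mpr fun ℓ ↦ ?_
  have hℓs : Continuous fun y ↦ ℓ (s (x, y)) :=
    ℓ.continuous.comp (hs.continuous.comp (by fun_prop))
  have hℓA : ∀ θ (n : ℤ), ∫ z, Real.cos (ν * n * z + θ) * ℓ (s (x, z)) = ℓ (A θ n x) := by
    intro θ n
    refine Eq.trans ?_
      (ℓ.integral_comp_comm (integrable_partial (hcos (ν * n) θ) hs.continuous hc x))
    simp
  have hsin : ∀ u : ℝ, Real.cos (u + -(Real.pi / 2)) = Real.sin u := fun u ↦ by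
    rw [← sub_eq_add_neg, Real.cos_sub_pi_div_two]
  have hsummA : ∀ θ, Summable fun n : ℤ ↦ ℓ (A θ n x) := by
    intro θ
    obtain ⟨C, -, hC⟩ := norm_le_of_rapid (hArapid θ 0) 2
    refine (Summable.of_norm_bounded (summable_inv_one_add_abs_sq.mul_left C)
      fun n ↦ ?_).mapL ℓ
    simpa using hC n x
  have hI0 : ∀ n : ℤ, ∫ z, Real.cos (ν * n * z) * ℓ (s (x, z)) = ℓ (A 0 n x) := fun n ↦ by
    rw [← hℓA]; simp
  have hI1 : ∀ n : ℤ, ∫ z, Real.sin (ν * n * z) * ℓ (s (x, z)) =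
      ℓ (A (-(Real.pi / 2)) n x) := fun n ↦ by
    rw [← hℓA]; simp only [hsin]
  have hsum := hasSum_cos_add_sin (T := T) hℓs hT hR
    (fun y hy ↦ by rw [hsR x y hy, map_zero])
    (by simpa only [← hνT, hI0] using hsummA 0)
    (by simpa only [← hνT, hI1] using hsummA _) hy
  rw [← hνT] at hsum
  have h0 := (hAsum 0).hasSum.mapL ℓ
  have h1 := (hAsum (-(Real.pi / 2))).hasSum.mapL ℓ
  have h2 := (h0.add h1).mul_left T⁻¹
  rw [map_smul, map_add, smul_eq_mul]
  refine hsum.unique (h2.congr_fun fun n ↦ ?_)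
  rw [hI0, hI1, map_smul, map_smul, hsin, smul_eq_mul, smul_eq_mul, add_zero]

/-- Generators of the sections over `U` also generate the families of sections that depend smoothly
on a real parameter: expand the family in a Fourier series, and lift the coefficients. -/
theorem GeneratesSections.prod_real {E : Type} [NormedAddCommGroup E] [NormedSpace ℝ E]
    [FiniteDimensional ℝ E] {U : Set E} (hU : IsOpen U) {D : E → Submodule ℝ F}
    {σ : Fin N → E → F} (h : GeneratesSections U D σ) :
    GeneratesSections (U ×ˢ (Set.univ : Set ℝ)) (fun z ↦ D z.1) fun a z ↦ σ a z.1 := by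
  intro s hs hc hsU hsD
  -- the projection of the support, and cutoff functions
  let K : TopologicalSpace.Compacts E := ⟨Prod.fst '' tsupport s, hc.isCompact.image continuous_fst⟩
  have hKU : (K : Set E) ⊆ U := by
    rintro _ ⟨z, hz, rfl⟩
    exact (hsU hz).1
  have hsK : ∀ x y, x ∉ K → s (x, y) = 0 := fun x y hx ↦ by
    by_contra h
    exact hx ⟨(x, y), subset_tsupport _ h, rfl⟩
  obtain ⟨χ, L, hχ, hL, -, hχ1, hχ0⟩ := exists_cutoff K.isCompact hU hKU
  let K' : TopologicalSpace.Compacts E := ⟨L, hL⟩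
  have hlift : ∀ s : E → F, ContDiff ℝ ∞ s → Function.support s ⊆ K → (∀ x, s x ∈ D x) →
      ∃ f : 𝓓_{K'}(E, Fin N → ℝ), ∀ x, s x = ∑ a, f x a • σ a x := by
    intro s hs hsK hsD
    have hts : tsupport s ⊆ K := closure_minimal hsK K.isCompact.isClosed
    obtain ⟨f, hf, hfs⟩ := h s hs (K.isCompact.of_isClosed_subset (isClosed_tsupport s) hts)
      (hts.trans hKU) hsD
    refine ⟨ContDiffMapSupportedIn.of_support_subset (f := fun x ↦ χ x • f x) (hχ.smul hf)
      fun x hx ↦ ?_, fun x ↦ ?_⟩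
    · by_contra hxL
      exact hx (by simp [hχ0 x hxL])
    · have h1 : s x = χ x • s x := by
        by_cases hx : x ∈ K
        · rw [hχ1 x hx, one_smul]
        · have : s x = 0 := by
            by_contra h
            exact hx (hsK h)
          rw [this, smul_zero]
      rw [h1, hfs x, Finset.smul_sum]
      exact Finset.sum_congr rfl fun a _ ↦ smul_smul _ _ _
  obtain ⟨R₁, hR₁, hsR⟩ := exists_abs_snd_le hc
  obtain ⟨R, hRdef⟩ : ∃ R, R = R₁ + 1 := ⟨_, rfl⟩
  obtain ⟨T, hT⟩ : ∃ T, T = 2 * R := ⟨_, rfl⟩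
  obtain ⟨ν, hνT⟩ : ∃ ν, ν = 2 * Real.pi / T := ⟨_, rfl⟩
  have hR : 0 < R := by rw [hRdef]; positivity
  have hν : 0 < ν := by rw [hνT, hT]; positivity
  obtain ⟨η, hη, hη1, hη0⟩ : ∃ η : ℝ → ℝ, ContDiff ℝ ∞ η ∧ (∀ y, |y| ≤ R₁ → η y = 1) ∧
      ∀ y, R ≤ |y| → η y = 0 := by
    let η : ContDiffBump (0 : ℝ) := ⟨R₁, R, hR₁, by rw [hRdef]; linarith⟩
    exact ⟨η, η.contDiff, fun y hy ↦ η.one_of_mem_closedBall (by simpa using hy),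
      fun y hy ↦ η.zero_of_le_dist (by simpa using hy)⟩
  have hcos : ∀ c θ : ℝ, Continuous fun y ↦ Real.cos (c * y + θ) := fun c θ ↦ by fun_prop
  have hcos1 : ∀ c θ y : ℝ, |Real.cos (c * y + θ)| ≤ 1 := fun c θ y ↦ Real.abs_cos_le_one _
  -- the partial Fourier coefficients of `s`
  let A : ℝ → ℤ → E → F := fun θ n ↦ partialIntegral (fun y ↦ Real.cos (ν * n * y + θ)) s
  have hArapid : ∀ θ (j q : ℕ), ∃ C, ∀ (n : ℤ) x,
      (1 + |(n : ℝ)|) ^ q * ‖iteratedFDeriv ℝ j (A θ n) x‖ ≤ C := by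
    intro θ j q
    obtain ⟨C, hC⟩ := exists_rapid_partialIntegral hν j q hs hc
    exact ⟨C, fun n x ↦ hC n θ x⟩
  have hfin : ∀ C : ℝ, {n : ℤ | 1 + |(n : ℝ)| ≤ C}.Finite := by
    intro C
    refine (Set.finite_Icc (-⌈C⌉) ⌈C⌉).subset fun n hn ↦ ?_
    have h1 : |(n : ℝ)| ≤ ⌈C⌉ := by
      have h2 : 1 + |(n : ℝ)| ≤ C := hn
      linarith [Int.le_ceil C]
    exact abs_le.mp (by exact_mod_cast h1)
  have hex : ∀ θ, ∃ f : ℤ → 𝓓_{K'}(E, Fin N → ℝ), (∀ n x, A θ n x = ∑ a, f n x a • σ a x) ∧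
      ∀ j q : ℕ, ∃ C, ∀ (n : ℤ) x, (1 + |(n : ℝ)|) ^ q * ‖iteratedFDeriv ℝ j (f n) x‖ ≤ C := by
    intro θ
    refine exists_rapid_lift hlift (fun n : ℤ ↦ 1 + |(n : ℝ)|)
      (fun n ↦ le_add_of_nonneg_right (abs_nonneg _)) hfin
      (fun n ↦ contDiff_partialIntegral (hcos _ θ) (hcos1 _ θ) hs hc) (fun n x hx ↦ ?_)
      (fun n x ↦ partialIntegral_mem (hcos _ θ) hs.continuous hc fun y ↦ hsD (x, y)) (hArapid θ)
    by_contra hxK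
    refine hx ?_
    simp [A, partialIntegral, hsK x _ hxK]
  choose f hfA hfrapid using hex
  let B : ℝ → E × ℝ → Fin N → ℝ := fun θ z ↦ ∑' n : ℤ, Real.cos (ν * n * z.2 + θ) • f θ n z.1
  have hB : ∀ θ, ContDiff ℝ ∞ (B θ) := fun θ ↦
    contDiff_tsum_cos_smul (fun n ↦ (f θ n).contDiff) (hfrapid θ) ν θ
  refine ⟨fun z ↦ (η z.2 * T⁻¹) • (B 0 z + B (-(Real.pi / 2)) z), ?_, fun z ↦ ?_⟩
  · exact ((hη.comp contDiff_snd).mul contDiff_const).smul ((hB _).add (hB _))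
  obtain ⟨x, y⟩ := z
  let Θ : (Fin N → ℝ) →L[ℝ] F :=
    LinearMap.toContinuousLinearMap (Fintype.linearCombination ℝ fun a ↦ σ a x)
  have hΘ : ∀ c, Θ c = ∑ a, c a • σ a x := fun c ↦ rfl
  rw [← hΘ, map_smul]
  by_cases hy : |y| ≤ R
  swap
  · rw [hη0 y (not_le.mp hy).le, zero_mul, zero_smul]
    exact hsR x y (by linarith)
  have hΘB : ∀ θ, Θ (B θ (x, y)) = ∑' n : ℤ, Real.cos (ν * n * y + θ) • A θ n x := by
    intro θ
    simp only [B]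
    rw [Θ.map_tsum (summable_cos_smul (hfrapid θ) ν θ x y)]
    exact tsum_congr fun n ↦ by rw [map_smul, hΘ, hfA]
  have hfourier : s (x, y) = T⁻¹ • Θ (B 0 (x, y) + B (-(Real.pi / 2)) (x, y)) := by
    rw [map_add, hΘB, hΘB]
    exact eq_tsum_partialIntegral hs hc hR hT hνT (fun x y h ↦ hsR x y (by linarith)) x hy
  rw [mul_smul, ← hfourier]
  rcases le_or_gt |y| R₁ with hy1 | hy1
  · rw [hη1 y hy1, one_smul]
  · rw [hsR x y hy1, smul_zero]

/-- Generators of the sections over `U` also generate the families of sections that depend smoothly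
on finitely many real parameters. -/
theorem GeneratesSections.prod {E : Type} [NormedAddCommGroup E] [NormedSpace ℝ E]
    [FiniteDimensional ℝ E] {U : Set E} (hU : IsOpen U) {D : E → Submodule ℝ F}
    {σ : Fin N → E → F} (h : GeneratesSections U D σ) (Y : Type) [NormedAddCommGroup Y]
    [NormedSpace ℝ Y] [FiniteDimensional ℝ Y] :
    GeneratesSections (U ×ˢ (Set.univ : Set Y)) (fun z ↦ D z.1) fun a z ↦ σ a z.1 := by
  induction hd : Module.finrank ℝ Y generalizing Y with
  | zero =>
    have : Subsingleton Y := Module.finrank_zero_iff.mp hd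
    have : Unique Y := ⟨⟨0⟩, fun y ↦ Subsingleton.elim _ _⟩
    have h1 := h.comp_equiv (ContinuousLinearEquiv.prodUnique ℝ E Y)
    have he : ∀ z, ContinuousLinearEquiv.prodUnique ℝ E Y z = z.1 := fun z ↦ by simp
    simp only [he] at h1
    convert h1 using 1
    ext z
    simp only [Set.mem_prod, Set.mem_univ, and_true, Set.mem_preimage, he]
  | succ d ih =>
    have h1 := ((ih (Fin d → ℝ) (by simp)).prod_real (hU.prod isOpen_univ))
    have e : Y ≃L[ℝ] (Fin d → ℝ) × ℝ := ContinuousLinearEquiv.ofFinrankEq (by simp [hd])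
    let e₁ := (ContinuousLinearEquiv.refl ℝ E).prodCongr e
    let e₂ := ContinuousLinearEquiv.prodAssoc ℝ E (Fin d → ℝ) ℝ
    have he : ∀ z, ((e₁.trans e₂.symm) z).1.1 = z.1 := by
      intro z
      have h3 : e₂ ((e₁.trans e₂.symm) z) = e₁ z := e₂.apply_symm_apply _
      exact congrArg Prod.fst h3
    have h2 := h1.comp_equiv (e₁.trans e₂.symm)
    simp only [he] at h2
    convert h2 using 1
    ext z
    simp only [Set.mem_prod, Set.mem_univ, and_true, Set.mem_preimage, he]

end Parameters

/-! ### Finite frames of vector bundles -/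

/-- The range of a `C¹` map from a manifold without boundary that is covered by countably many of
its charts has Hausdorff dimension at most the dimension of the manifold. -/
theorem dimH_range_le_of_contMDiff {E : Type*} [NormedAddCommGroup E] [NormedSpace ℝ E]
    [FiniteDimensional ℝ E] {H : Type*} [TopologicalSpace H] {I : ModelWithCorners ℝ E H}
    [I.Boundaryless] {N : Type*} [TopologicalSpace N] [ChartedSpace H N] [IsManifold I 1 N]
    {G : Type*} [NormedAddCommGroup G] [NormedSpace ℝ G] {f : N → G}
    (hf : ContMDiff I 𝓘(ℝ, G) 1 f) {S : Set N} (hS : S.Countable)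
    (hcov : ∀ x, ∃ c ∈ S, x ∈ (chartAt H c).source) :
    dimH (Set.range f) ≤ Module.finrank ℝ E := by
  have hrange : Set.range f ⊆
      ⋃ c ∈ S, (f ∘ (extChartAt I c).symm) '' (extChartAt I c).target := by
    rintro _ ⟨x, rfl⟩
    obtain ⟨c, hc, hx⟩ := hcov x
    have hx' : x ∈ (extChartAt I c).source := by rwa [extChartAt_source]
    refine Set.mem_biUnion hc ⟨extChartAt I c x, (extChartAt I c).map_source hx', ?_⟩
    exact congrArg f ((extChartAt I c).left_inv hx')
  refine (dimH_mono hrange).trans ?_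
  rw [dimH_bUnion hS]
  refine iSup₂_le fun c _ ↦ ?_
  refine (dimH_image_le_of_locally_lipschitzOn fun y hy ↦ ?_).trans
    ((dimH_mono (Set.subset_univ _)).trans (Real.dimH_univ_eq_finrank E).le)
  have hnhds := (isOpen_extChartAt_target (I := I) c).mem_nhds hy
  have h1 : ContMDiffAt 𝓘(ℝ, E) 𝓘(ℝ, G) 1 (f ∘ (extChartAt I c).symm) y :=
    (hf _).comp y ((contMDiffOn_extChartAt_symm c y hy).contMDiffAt hnhds)
  obtain ⟨C, t, ht, hC⟩ := h1.contDiffAt.exists_lipschitzOnWith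
  exact ⟨C, t, mem_nhdsWithin_of_mem_nhds ht, hC⟩

section Frames

variable {m : ℕ} {M : Type*} [TopologicalSpace M] [ChartedSpace (EuclideanSpace ℝ (Fin m)) M]
  {F : Type*} [NormedAddCommGroup F] [NormedSpace ℝ F]
  {V : M → Type*} [TopologicalSpace (Bundle.TotalSpace F V)]
  [∀ x, AddCommGroup (V x)] [∀ x, Module ℝ (V x)] [∀ x, TopologicalSpace (V x)]
  [FiberBundle F V]

variable (m F) in
/-- A family of linear maps from the fibres of a vector bundle to a fixed vector space is smooth if
it is smooth as a function on the total space. -/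
def IsSmoothFamily {W : Type*} [NormedAddCommGroup W] [NormedSpace ℝ W]
    (A : ∀ x, V x →ₗ[ℝ] W) : Prop :=
  ContMDiff ((𝓡 m).prod 𝓘(ℝ, F)) 𝓘(ℝ, W) ∞ fun v : Bundle.TotalSpace F V ↦ A v.1 v.2

theorem IsSmoothFamily.clm_comp {W W' : Type*} [NormedAddCommGroup W] [NormedSpace ℝ W]
    [NormedAddCommGroup W'] [NormedSpace ℝ W'] {A : ∀ x, V x →ₗ[ℝ] W} (hA : IsSmoothFamily m F A)
    (L : W →L[ℝ] W') : IsSmoothFamily m F fun x ↦ L.toLinearMap ∘ₗ A x :=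
  L.contMDiff.comp hA

theorem IsSmoothFamily.prod {W W' : Type*} [NormedAddCommGroup W] [NormedSpace ℝ W]
    [NormedAddCommGroup W'] [NormedSpace ℝ W'] {A : ∀ x, V x →ₗ[ℝ] W} {B : ∀ x, V x →ₗ[ℝ] W'}
    (hA : IsSmoothFamily m F A) (hB : IsSmoothFamily m F B) :
    IsSmoothFamily m F fun x ↦ (A x).prod (B x) :=
  hA.prodMk_space hB

theorem IsSmoothFamily.smul [VectorBundle ℝ F V]
    [ContMDiffVectorBundle ∞ F V (𝓡 m)]
    {W : Type*} [NormedAddCommGroup W] [NormedSpace ℝ W] {A : ∀ x, V x →ₗ[ℝ] W}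
    (hA : IsSmoothFamily m F A) {χ : M → ℝ} (hχ : ContMDiff (𝓡 m) 𝓘(ℝ) ∞ χ) :
    IsSmoothFamily m F fun x ↦ χ x • A x :=
  (hχ.comp (Bundle.contMDiff_proj V)).smul hA

variable [VectorBundle ℝ F V] [IsManifold (𝓡 m) ∞ M] [ContMDiffVectorBundle ∞ F V (𝓡 m)]

theorem exists_isSmoothFamily_injective_nhds [T2Space M] (x₀ : M) :
    ∃ A : ∀ x, V x →ₗ[ℝ] F, IsSmoothFamily m F A ∧ ∀ᶠ x in 𝓝 x₀, Function.Injective (A x) := by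
  set e := trivializationAt F V x₀ with he
  have hx₀ : x₀ ∈ e.baseSet := FiberBundle.mem_baseSet_trivializationAt' x₀
  obtain ⟨χ, -, hχ⟩ := (SmoothBumpFunction.nhds_basis_tsupport (I := 𝓡 m) x₀).mem_iff.mp
    (e.open_baseSet.mem_nhds hx₀)
  refine ⟨fun x ↦ χ x • e.linearMapAt ℝ x, fun v ↦ ?_, ?_⟩
  · by_cases hv : v.1 ∈ e.baseSet
    · have h1 : ContMDiffAt ((𝓡 m).prod 𝓘(ℝ, F)) 𝓘(ℝ, F) ∞
          (fun w : Bundle.TotalSpace F V ↦ (e w).2) v :=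
        (contMDiffAt_snd.comp v ((e.contMDiffOn (n := ∞) (IB := 𝓡 m) v
          (e.mem_source.mpr hv)).contMDiffAt (e.open_source.mem_nhds (e.mem_source.mpr hv))) :)
      refine (((χ.contMDiff.comp (Bundle.contMDiff_proj V)) v).smul h1).congr_of_eventuallyEq ?_
      filter_upwards [e.open_source.mem_nhds (e.mem_source.mpr hv)] with w hw
      simp [e.linearMapAt_apply, e.mem_source.mp hw]
    · have h0 : ∀ᶠ w : Bundle.TotalSpace F V in 𝓝 v, w.1 ∉ tsupport χ :=
        (FiberBundle.continuous_proj F V).continuousAt.eventually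
          ((isClosed_tsupport _).isOpen_compl.mem_nhds fun h ↦ hv (hχ h))
      refine (contMDiffAt_const (c := (0 : F))).congr_of_eventuallyEq ?_
      filter_upwards [h0] with w hw
      simp [image_eq_zero_of_notMem_tsupport hw]
  · filter_upwards [χ.eventuallyEq_one, e.open_baseSet.mem_nhds hx₀] with x hx hxe
    intro v w hvw
    have hx1 : χ x = 1 := hx
    simp only [hx1, one_smul] at hvw
    apply (e.linearEquivAt ℝ x hxe).injective
    simpa [e.linearMapAt_apply, hxe] using hvw

theorem exists_isSmoothFamily_injOn_of_isCompact [FiniteDimensional ℝ F] [T2Space M] {K : Set M}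
    (hK : IsCompact K) :
    ∃ q, ∃ A : ∀ x, V x →ₗ[ℝ] (Fin q → ℝ), IsSmoothFamily m F A ∧
      ∀ x ∈ K, Function.Injective (A x) := by
  have hfin : ∀ (W : Type _) [NormedAddCommGroup W] [NormedSpace ℝ W] [FiniteDimensional ℝ W]
      (S : Set M) (A : ∀ x, V x →ₗ[ℝ] W), IsSmoothFamily m F A →
      (∀ x ∈ S, Function.Injective (A x)) →
      ∃ q, ∃ A : ∀ x, V x →ₗ[ℝ] (Fin q → ℝ), IsSmoothFamily m F A ∧
        ∀ x ∈ S, Function.Injective (A x) := fun W _ _ _ S A hA hinj ↦ by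
    let L : W ≃L[ℝ] (Fin (Module.finrank ℝ W) → ℝ) :=
      ContinuousLinearEquiv.ofFinrankEq (by simp)
    exact ⟨_, _, hA.clm_comp L.toContinuousLinearMap, fun x hx ↦ L.injective.comp (hinj x hx)⟩
  refine hK.induction_on (p := fun S ↦ ∃ q, ∃ A : ∀ x, V x →ₗ[ℝ] (Fin q → ℝ),
    IsSmoothFamily m F A ∧ ∀ x ∈ S, Function.Injective (A x)) ?_ ?_ ?_ ?_
  · exact ⟨0, fun _ ↦ 0, contMDiff_const, fun x hx ↦ hx.elim⟩
  · rintro s t hst ⟨q, A, hA, h⟩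
    exact ⟨q, A, hA, fun x hx ↦ h x (hst hx)⟩
  · rintro s t ⟨q, A, hA, h⟩ ⟨q', A', hA', h'⟩
    obtain ⟨q'', L⟩ : ∃ q'', Nonempty (((Fin q → ℝ) × (Fin q' → ℝ)) ≃L[ℝ] (Fin q'' → ℝ)) :=
      ⟨q + q', ⟨ContinuousLinearEquiv.ofFinrankEq (by simp)⟩⟩
    obtain ⟨L⟩ := L
    refine ⟨q'', _, (hA.prod hA').clm_comp L.toContinuousLinearMap, fun x hx ↦ L.injective.comp ?_⟩
    intro v w hvw
    have h12 := Prod.ext_iff.mp hvw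
    exact hx.elim (fun hx ↦ h x hx h12.1) fun hx ↦ h' x hx h12.2
  · intro x _
    obtain ⟨A, hA, hx⟩ := exists_isSmoothFamily_injective_nhds (m := m) (F := F) (V := V) x
    exact ⟨_, mem_nhdsWithin_of_mem_nhds hx, hfin F _ A hA fun y hy ↦ hy⟩

/-- A smooth family of linear maps to a space of dimension greater than that of the total space can
be composed with a projection along a line that its range does not contain. -/
theorem IsSmoothFamily.exists_reduce_dimension [FiniteDimensional ℝ F] [SecondCountableTopology M]
    {q : ℕ} (hq : m + Module.finrank ℝ F ≤ q) {A : ∀ x, V x →ₗ[ℝ] (Fin (q + 1) → ℝ)}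
    (hA : IsSmoothFamily m F A) :
    ∃ B : ∀ x, V x →ₗ[ℝ] (Fin q → ℝ), IsSmoothFamily m F B ∧
      ∀ x, Function.Injective (A x) → Function.Injective (B x) := by
  rcases isEmpty_or_nonempty M with hM | ⟨⟨x₀⟩⟩
  · exact ⟨fun _ ↦ 0, contMDiff_const, fun x ↦ hM.elim x⟩
  obtain ⟨S, hS, hcov⟩ := TopologicalSpace.countable_cover_nhds
    (f := fun x : M ↦ (trivializationAt F V x).baseSet ∩
      (chartAt (EuclideanSpace ℝ (Fin m)) x).source) fun x ↦ Filter.inter_mem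
        ((trivializationAt F V x).open_baseSet.mem_nhds
          (FiberBundle.mem_baseSet_trivializationAt' x)) (chart_source_mem_nhds _ x)
  have hdim := dimH_range_le_of_contMDiff (hA.of_le (by simp)) (hS.image
    fun x ↦ (⟨x, 0⟩ : Bundle.TotalSpace F V)) fun v ↦ by
      obtain ⟨x, hx, hv⟩ := Set.mem_iUnion₂.mp ((Set.ext_iff.mp hcov v.1).mpr trivial)
      refine ⟨_, Set.mem_image_of_mem _ hx, ?_⟩
      rw [FiberBundle.chartedSpace_chartAt]
      simp only [OpenPartialHomeomorph.trans_source, Set.mem_inter_iff, Set.mem_preimage]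
      refine ⟨(Bundle.Trivialization.mem_source _).mpr hv.1, ?_, trivial⟩
      change (trivializationAt F V x v).1 ∈ _
      rw [(trivializationAt F V x).coe_fst' hv.1]
      exact hv.2
  have hlt : dimH (Set.range fun v : Bundle.TotalSpace F V ↦ A v.1 v.2) <
      Module.finrank ℝ (Fin (q + 1) → ℝ) := by
    refine hdim.trans_lt (Nat.cast_lt.mpr ?_)
    rw [Module.finrank_prod, finrank_euclideanSpace_fin, Module.finrank_fin_fun]
    omega
  obtain ⟨w, hw⟩ := (dense_compl_of_dimH_lt_finrank hlt).nonempty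
  have hw' : ∀ x v, A x v ≠ w := fun x v h ↦ hw ⟨⟨x, v⟩, h⟩
  have hw0 : w ≠ 0 := fun h ↦ hw' x₀ 0 (by simp [h])
  have hrank : Module.finrank ℝ ((Fin (q + 1) → ℝ) ⧸ Submodule.span ℝ {w}) =
      Module.finrank ℝ (Fin q → ℝ) := by
    have := Submodule.finrank_quotient_add_finrank (Submodule.span ℝ {w})
    rw [finrank_span_singleton hw0] at this
    simp only [Module.finrank_fin_fun] at this ⊢
    omega
  let L : (Fin (q + 1) → ℝ) →ₗ[ℝ] (Fin q → ℝ) :=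
    (LinearEquiv.ofFinrankEq _ _ hrank).toLinearMap ∘ₗ (Submodule.span ℝ {w}).mkQ
  refine ⟨_, hA.clm_comp (LinearMap.toContinuousLinearMap L), fun x hx ↦ ?_⟩
  rw [← LinearMap.ker_eq_bot, LinearMap.ker_eq_bot'] at hx ⊢
  intro v hv
  have hv' : A x v ∈ Submodule.span ℝ {w} := by
    have : (LinearEquiv.ofFinrankEq _ _ hrank) ((Submodule.span ℝ {w}).mkQ (A x v)) = 0 := hv
    rwa [LinearEquiv.map_eq_zero_iff, Submodule.mkQ_apply, Submodule.Quotient.mk_eq_zero] at this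
  obtain ⟨c, hc⟩ := Submodule.mem_span_singleton.mp hv'
  rcases eq_or_ne c 0 with rfl | hc0
  · exact hx v (by rw [← hc, zero_smul])
  · exact absurd (by rw [map_smul, ← hc, inv_smul_smul₀ hc0]) (hw' x (c⁻¹ • v))

/-- The target dimension is uniform in the compact set `K`, which makes the families over an
exhaustion of the base fit together. -/
theorem exists_isSmoothFamily_injOn_of_isCompact_of_finrank [FiniteDimensional ℝ F] [T2Space M]
    [SecondCountableTopology M] {K : Set M} (hK : IsCompact K) :
    ∃ A : ∀ x, V x →ₗ[ℝ] (Fin (m + Module.finrank ℝ F) → ℝ), IsSmoothFamily m F A ∧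
      ∀ x ∈ K, Function.Injective (A x) := by
  obtain ⟨q, A, hA, hinj⟩ := exists_isSmoothFamily_injOn_of_isCompact (m := m) (F := F) (V := V) hK
  set d := m + Module.finrank ℝ F with hd
  rcases le_total q d with hqd | hqd
  · let L : (Fin q → ℝ) →ₗ[ℝ] (Fin d → ℝ) :=
      Function.ExtendByZero.linearMap ℝ (Fin.castLE hqd)
    refine ⟨_, hA.clm_comp (LinearMap.toContinuousLinearMap L), fun x hx ↦
      Function.Injective.comp (g := L) (fun v w hvw ↦ ?_) (hinj x hx)⟩
    funext i
    have := congrFun hvw (Fin.castLE hqd i)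
    simpa [L, (Fin.castLE_injective hqd).extend_apply] using this
  · induction q, hqd using Nat.le_induction with
    | base => exact ⟨A, hA, hinj⟩
    | succ q hq ih =>
      obtain ⟨B, hB, hAB⟩ := hA.exists_reduce_dimension hq
      exact ih B hB fun x hx ↦ hAB x (hinj x hx)

/-- The index of parity `c` (for `c = 0, 1`) next to the real number `t ≥ 0`. -/
def parityIndex (c : ℕ) (t : ℝ) : ℕ := c + 2 * ⌊(t - c + 1) / 2⌋₊

theorem abs_sub_parityIndex_le {c : ℕ} (hc : c ≤ 1) {t : ℝ} (ht : 0 ≤ t) :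
    |t - parityIndex c t| ≤ 1 := by
  have hc' : (c : ℝ) ≤ 1 := by exact_mod_cast hc
  have h1 := Nat.floor_le (show 0 ≤ (t - c + 1) / 2 by linarith)
  have h2 := Nat.lt_floor_add_one ((t - c + 1) / 2)
  rw [abs_le, parityIndex]
  push_cast
  constructor <;> linarith

theorem two_le_abs_sub_parityIndex {c : ℕ} {t t' : ℝ} (h : parityIndex c t ≠ parityIndex c t') :
    (2 : ℝ) ≤ |(parityIndex c t : ℝ) - parityIndex c t'| := by
  have h' : (2 : ℤ) ≤ |(parityIndex c t : ℤ) - parityIndex c t'| := by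
    rw [le_abs]
    unfold parityIndex at *
    push_cast
    omega
  exact_mod_cast h'

theorem exists_abs_sub_parityIndex_le_half {t : ℝ} (ht : 0 ≤ t) :
    |t - parityIndex 0 t| ≤ 1 / 2 ∨ |t - parityIndex 1 t| ≤ 1 / 2 := by
  have key : ∀ (c k : ℕ), |t - (c + 2 * k : ℕ)| < 1 → parityIndex c t = c + 2 * k := by
    intro c k h
    rw [abs_lt] at h
    push_cast at h
    have hk : ⌊(t - c + 1) / 2⌋₊ = k := by
      rw [Nat.floor_eq_iff (by linarith [k.cast_nonneg (α := ℝ)])]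
      constructor <;> linarith
    rw [parityIndex, hk]
  have h1 := Nat.floor_le (show 0 ≤ t + 1 / 2 by linarith)
  have h2 := Nat.lt_floor_add_one (t + 1 / 2)
  have h3 : |t - ⌊t + 1 / 2⌋₊| ≤ 1 / 2 := by
    rw [abs_le]
    constructor <;> linarith
  obtain ⟨k, hk | hk⟩ := Nat.even_or_odd' ⌊t + 1 / 2⌋₊
  · left
    rw [hk] at h3
    rwa [key 0 k (by rw [Nat.zero_add]; linarith), Nat.zero_add]
  · right
    rw [hk, add_comm] at h3
    rwa [key 1 k (by linarith)]

theorem exists_isSmoothFamily_injective [FiniteDimensional ℝ F] [T2Space M]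
    [SecondCountableTopology M] :
    ∃ N, ∃ A : ∀ x, V x →ₗ[ℝ] (Fin N → ℝ), IsSmoothFamily m F A ∧
      ∀ x, Function.Injective (A x) := by
  have : LocallyCompactSpace M := ChartedSpace.locallyCompactSpace (EuclideanSpace ℝ (Fin m)) M
  let K := CompactExhaustion.choice M
  obtain ⟨f, hf⟩ := exists_contMDiffMap_forall_mem_convex_of_local_const (𝓡 m) (n := ⊤)
    (t := fun x ↦ Set.Ici (K.find x : ℝ)) (fun x ↦ convex_Ici _) fun x ↦ by
      refine ⟨K.find x + 1, ?_⟩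
      filter_upwards [mem_interior_iff_mem_nhds.mp (K.subset_interior_succ _ (K.mem_find x))]
        with y hy
      have := K.mem_iff_find_le.mp hy
      rw [Set.mem_Ici]
      exact_mod_cast this
  have hf0 : ∀ x, 0 ≤ f x := fun x ↦ (Nat.cast_nonneg _).trans (hf x)
  choose A hA hinj using fun i ↦ exists_isSmoothFamily_injOn_of_isCompact_of_finrank
    (m := m) (F := F) (V := V) (K.isCompact i)
  let β : ContDiffBump (0 : ℝ) := ⟨1 / 2, 3 / 4, by norm_num, by norm_num⟩
  have hβ0 : ∀ t : ℝ, 3 / 4 ≤ |t| → β t = 0 := fun t ht ↦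
    β.zero_of_le_dist (by rwa [dist_zero_right])
  have hβ1 : ∀ t : ℝ, |t| ≤ 1 / 2 → β t = 1 := fun t ht ↦
    β.one_of_mem_closedBall (by rwa [mem_closedBall_zero_iff])
  -- The supports of the summands of one parity are disjoint, so that a sum is not needed.
  let B (c : ℕ) (x : M) : V x →ₗ[ℝ] (Fin (m + Module.finrank ℝ F) → ℝ) :=
    β (f x - parityIndex c (f x)) • A (parityIndex c (f x)) x
  have hB : ∀ c ≤ 1, IsSmoothFamily m F (B c) := by
    intro c hc v
    set i := parityIndex c (f v.1) with hi
    have h1 : IsSmoothFamily m F fun x ↦ β (f x - i) • A i x :=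
      (hA i).smul (β.contDiff.contMDiff.comp (f.contMDiff.sub contMDiff_const))
    refine (h1 v).congr_of_eventuallyEq ?_
    have h2 : ∀ᶠ w : Bundle.TotalSpace F V in 𝓝 v, |f w.1 - f v.1| < 1 / 4 :=
      (f.contMDiff.continuous.comp (FiberBundle.continuous_proj F V)).continuousAt.eventually
        (Metric.ball_mem_nhds _ (by norm_num))
    filter_upwards [h2] with w hw
    rcases eq_or_ne (parityIndex c (f w.1)) i with h | h
    · simp only [B]
      rw [h]
    · have h3 := two_le_abs_sub_parityIndex h
      have h4 := abs_sub_parityIndex_le hc (hf0 v.1)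
      have h5 := abs_sub_parityIndex_le hc (hf0 w.1)
      have h6 : β (f w.1 - parityIndex c (f w.1)) = 0 := by
        apply hβ0
        rw [← hi] at h4
        rw [abs_lt] at hw
        rw [abs_le] at h4 h5
        rw [le_abs] at h3 ⊢
        rcases h3 with h3 | h3
        · right; linarith
        · left; linarith
      have h7 : β (f w.1 - i) = 0 := by
        apply hβ0
        rw [← hi] at h3
        rw [abs_le] at h5
        rw [le_abs] at h3 ⊢
        rcases h3 with h3 | h3
        · left; linarith
        · right; linarith
      simp [B, h6, h7]
  have hBinj : ∀ c x, |f x - parityIndex c (f x)| ≤ 1 / 2 → Function.Injective (B c x) := by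
    intro c x hx
    have hmem : x ∈ K (parityIndex c (f x)) := by
      rw [K.mem_iff_find_le]
      have h1 : (K.find x : ℝ) ≤ f x := hf x
      have h2 : (K.find x : ℝ) < parityIndex c (f x) + 1 := by
        rw [abs_le] at hx
        linarith
      exact Nat.lt_succ_iff.mp (by exact_mod_cast h2)
    simpa only [B, hβ1 _ hx, one_smul] using hinj _ x hmem
  let L : ((Fin (m + Module.finrank ℝ F) → ℝ) × (Fin (m + Module.finrank ℝ F) → ℝ)) ≃L[ℝ]
      (Fin (m + Module.finrank ℝ F + (m + Module.finrank ℝ F)) → ℝ) :=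
    ContinuousLinearEquiv.ofFinrankEq (by simp)
  refine ⟨_, _, ((hB 0 zero_le_one).prod (hB 1 le_rfl)).clm_comp L.toContinuousLinearMap,
    fun x ↦ L.injective.comp fun v w hvw ↦ ?_⟩
  have h12 := Prod.ext_iff.mp hvw
  exact (exists_abs_sub_parityIndex_le_half (hf0 x)).elim (fun h ↦ hBinj 0 x h h12.1)
    fun h ↦ hBinj 1 x h h12.2

/-- The frame is `e_a = A⁺ δ_a`, where `A⁺` is the pseudo-inverse of the injective map `A`, that is,
`⟨A e_a, A w⟩ = (A w)_a` for all `w`. -/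
theorem exists_finite_frame [FiniteDimensional ℝ F] [T2Space M] [SecondCountableTopology M] :
    ∃ N, ∃ A : ∀ x, V x →ₗ[ℝ] (Fin N → ℝ), IsSmoothFamily m F A ∧
      ∃ e : Fin N → Cₛ^∞⟮𝓡 m; F, V⟯, ∀ x (v : V x), ∑ a, A x v a • e a x = v := by
  obtain ⟨N, A, hA, hinj⟩ := exists_isSmoothFamily_injective (m := m) (F := F) (V := V)
  refine ⟨N, A, hA, ?_⟩
  have huniq : ∀ x (u u' : V x), (∀ w, ∑ b, A x u b * A x w b = ∑ b, A x u' b * A x w b) →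
      u = u' := by
    intro x u u' h
    apply hinj x
    rw [← sub_eq_zero, ← map_sub]
    have h1 : ∑ b, A x (u - u') b * A x (u - u') b = 0 := by
      conv_lhs => enter [2, b, 1]; rw [map_sub, Pi.sub_apply]
      simp only [sub_mul, Finset.sum_sub_distrib, h (u - u'), sub_self]
    funext b
    exact mul_self_eq_zero.mp ((Finset.sum_eq_zero_iff_of_nonneg
      fun b _ ↦ mul_self_nonneg (A x (u - u') b)).mp h1 b (Finset.mem_univ b))
  -- The coordinates of `A`, in the trivialization around `x₀`.
  let α (x₀ : M) (b : Fin N) (x : M) : F →L[ℝ] ℝ := LinearMap.toContinuousLinearMap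
    (LinearMap.proj b ∘ₗ A x ∘ₗ (trivializationAt F V x₀).symmₗ ℝ x)
  have hαapply : ∀ x₀ b x, x ∈ (trivializationAt F V x₀).baseSet → ∀ f,
      α x₀ b x f = A x ((trivializationAt F V x₀).symm x f) b := by
    intro x₀ b x hx f
    rw [← (trivializationAt F V x₀).coe_symmₗ (R := ℝ) hx]
    rfl
  have hα : ∀ x₀ b, ContMDiffAt (𝓡 m) 𝓘(ℝ, F →L[ℝ] ℝ) ∞ (α x₀ b) x₀ := by
    intro x₀ b
    set t := trivializationAt F V x₀ with ht
    have hx₀ : x₀ ∈ t.baseSet := FiberBundle.mem_baseSet_trivializationAt' x₀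
    have h1 : ∀ f : F, ContMDiffAt (𝓡 m) 𝓘(ℝ, ℝ) ∞ (fun x ↦ α x₀ b x f) x₀ := by
      intro f
      have h2 : ContMDiffAt (𝓡 m) ((𝓡 m).prod 𝓘(ℝ, F)) ∞
          (fun x ↦ (⟨x, t.symm x f⟩ : Bundle.TotalSpace F V)) x₀ := by
        refine (t.contMDiffAt_section_iff (IB := 𝓡 m) hx₀).mpr ?_
        refine (contMDiffAt_const (c := f)).congr_of_eventuallyEq ?_
        filter_upwards [t.open_baseSet.mem_nhds hx₀] with x hx
        rw [t.apply_mk_symm hx]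
      refine (((ContinuousLinearMap.proj (R := ℝ) (φ := fun _ : Fin N ↦ ℝ) b).contMDiff.contMDiffAt
        (x := A x₀ (t.symm x₀ f))).comp x₀ ((hA _).comp x₀ h2)).congr_of_eventuallyEq ?_
      filter_upwards [t.open_baseSet.mem_nhds hx₀] with x hx
      exact hαapply x₀ b x hx f
    let bF := Module.finBasis ℝ F
    have h3 : ∀ x, α x₀ b x =
        ∑ i, α x₀ b x (bF i) • LinearMap.toContinuousLinearMap (bF.coord i) := by
      intro x
      ext f
      conv_lhs => rw [← bF.sum_repr f, map_sum]
      simp [mul_comm]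
    have h4 : ContMDiffAt (𝓡 m) 𝓘(ℝ, F →L[ℝ] ℝ) ∞ (fun x ↦
        ∑ i, α x₀ b x (bF i) • LinearMap.toContinuousLinearMap (bF.coord i)) x₀ :=
      contMDiffAt_finsetSum fun i _ ↦ (h1 (bF i)).smul contMDiffAt_const
    exact h4.congr_of_eventuallyEq (Filter.Eventually.of_forall h3)
  let G (x₀ x : M) : F →L[ℝ] (F →L[ℝ] ℝ) := ∑ b, (α x₀ b x).smulRight (α x₀ b x)
  have hG : ∀ x₀, ContMDiffAt (𝓡 m) 𝓘(ℝ, F →L[ℝ] (F →L[ℝ] ℝ)) ∞ (G x₀) x₀ := by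
    intro x₀
    refine contMDiffAt_finsetSum fun b _ ↦ ?_
    have h1 : ContDiff ℝ ∞ fun p : (F →L[ℝ] ℝ) × (F →L[ℝ] ℝ) ↦ p.1.smulRight p.2 :=
      isBoundedBilinearMap_smulRight.contDiff
    exact h1.contMDiff.contMDiffAt.comp x₀ ((hα x₀ b).prodMk_space (hα x₀ b))
  have hGapply : ∀ x₀ x f g, G x₀ x f g = ∑ b, α x₀ b x f * α x₀ b x g := by
    intro x₀ x f g
    simp [G]
  have hGinv : ∀ x₀ x, x ∈ (trivializationAt F V x₀).baseSet →
      ∃ L : F ≃L[ℝ] (F →L[ℝ] ℝ), (L : F →L[ℝ] (F →L[ℝ] ℝ)) = G x₀ x := by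
    intro x₀ x hx
    have hi : Function.Injective (G x₀ x : F →ₗ[ℝ] (F →L[ℝ] ℝ)) := by
      rw [← LinearMap.ker_eq_bot, LinearMap.ker_eq_bot']
      intro f hf
      have h1 : (trivializationAt F V x₀).symm x f = 0 := by
        apply huniq
        intro w
        obtain ⟨g, rfl⟩ : ∃ g, (trivializationAt F V x₀).symm x g = w :=
          ⟨_, (trivializationAt F V x₀).symm_apply_apply_mk hx w⟩
        have h2 : G x₀ x f g = 0 := by
          rw [show G x₀ x f = 0 from hf]
          rfl
        simpa [hGapply, hαapply, hx] using h2
      have h2 := (trivializationAt F V x₀).apply_mk_symm hx f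
      rw [h1] at h2
      have h3 := congrArg Prod.snd h2
      rw [show f = ((x, f) : M × F).2 from rfl, ← h3]
      exact ((trivializationAt F V x₀).linear ℝ hx).map_zero
    have hr : Module.finrank ℝ F = Module.finrank ℝ (F →L[ℝ] ℝ) := by
      rw [← (LinearMap.toContinuousLinearMap (𝕜 := ℝ) (E := F) (F' := ℝ)).finrank_eq]
      exact (Subspace.dual_finrank_eq).symm
    let L := (LinearEquiv.ofInjectiveOfFinrankEq (G x₀ x : F →ₗ[ℝ] (F →L[ℝ] ℝ)) hi hr)
    exact ⟨L.toContinuousLinearEquiv, by ext; rfl⟩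
  have hloc : ∀ x₀ a x, x ∈ (trivializationAt F V x₀).baseSet → ∀ w,
      ∑ b, A x ((trivializationAt F V x₀).symm x ((G x₀ x).inverse (α x₀ a x))) b * A x w b =
        A x w a := by
    intro x₀ a x hx w
    obtain ⟨L, hL⟩ := hGinv x₀ x hx
    obtain ⟨g, rfl⟩ : ∃ g, (trivializationAt F V x₀).symm x g = w :=
      ⟨_, (trivializationAt F V x₀).symm_apply_apply_mk hx w⟩
    have h1 : G x₀ x ((G x₀ x).inverse (α x₀ a x)) g = α x₀ a x g := by
      rw [← hL]
      simp
    simpa only [hGapply, hαapply _ _ x hx] using h1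
  choose e he using fun (a : Fin N) (x : M) ↦
    (⟨_, hloc x a x (FiberBundle.mem_baseSet_trivializationAt' x)⟩ :
      ∃ v : V x, ∀ w, ∑ b, A x v b * A x w b = A x w a)
  refine ⟨fun a ↦ ⟨e a, fun x₀ ↦ ?_⟩, fun x v ↦ huniq x _ _ fun w ↦ ?_⟩
  · have hx₀ : x₀ ∈ (trivializationAt F V x₀).baseSet :=
      FiberBundle.mem_baseSet_trivializationAt' x₀
    obtain ⟨L, hL⟩ := hGinv x₀ x₀ hx₀
    have hinv : ContMDiffAt (𝓡 m) 𝓘(ℝ, (F →L[ℝ] ℝ) →L[ℝ] F) ∞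
        (fun x ↦ (G x₀ x).inverse) x₀ := by
      have h1 : ContDiffAt ℝ ∞ (ContinuousLinearMap.inverse (R := ℝ)
        (M := F) (M₂ := F →L[ℝ] ℝ)) (G x₀ x₀) := hL ▸ contDiffAt_map_inverse L
      exact h1.contMDiffAt.comp x₀ (hG x₀)
    refine (Bundle.contMDiffAt_section x₀).mpr
      ((hinv.clm_apply (hα x₀ a)).congr_of_eventuallyEq ?_)
    filter_upwards [(trivializationAt F V x₀).open_baseSet.mem_nhds hx₀] with x hx
    rw [huniq x _ _ fun w ↦ (he a x w).trans (hloc x₀ a x hx w).symm,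
      (trivializationAt F V x₀).apply_mk_symm hx]
  · simp only [map_sum, map_smul, Finset.sum_apply, Pi.smul_apply, smul_eq_mul, Finset.sum_mul]
    rw [Finset.sum_comm]
    refine Finset.sum_congr rfl fun a _ ↦ ?_
    rw [← he a x w, Finset.mul_sum]
    exact Finset.sum_congr rfl fun b _ ↦ mul_assoc _ _ _

end Frames

/-! ### Smooth sections of vector bundles and of their quotients -/

/-- Near each of its points, a manifold is a smooth retract of a plot. -/
theorem exists_plot_nhds {n : ℕ} {N : Type*} [TopologicalSpace N]
    [ChartedSpace (EuclideanSpace ℝ (Fin n)) N] [IsManifold (𝓡 n) ∞ N] (p₀ : N) :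
    ∃ (c : EuclideanSpace ℝ (Fin n) → N) (φ : N → EuclideanSpace ℝ (Fin n)) (U : Set N),
      ContMDiff (𝓡 n) (𝓡 n) ∞ c ∧ IsOpen U ∧ p₀ ∈ U ∧ ContMDiffOn (𝓡 n) (𝓡 n) ∞ φ U ∧
        ∀ p ∈ U, c (φ p) = p := by
  set ψ := extChartAt (𝓡 n) p₀ with hψ
  have hmem : ψ p₀ ∈ ψ.target := mem_extChartAt_target p₀
  obtain ⟨r, hr, hrt, hrid⟩ := exists_smooth_retract (isOpen_extChartAt_target p₀) hmem
  obtain ⟨u, hu, huo, hpu⟩ := eventually_nhds_iff.mp hrid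
  refine ⟨ψ.symm ∘ r, ψ, ψ.source ∩ ψ ⁻¹' u, ?_, ?_, ⟨mem_extChartAt_source p₀, hpu⟩, ?_, ?_⟩
  · exact (contMDiffOn_extChartAt_symm p₀).comp_contMDiff hr.contMDiff hrt
  · exact (continuousOn_extChartAt p₀).isOpen_inter_preimage (isOpen_extChartAt_source p₀) huo
  · refine (contMDiffOn_extChartAt (x := p₀)).mono ?_
    rw [← extChartAt_source (𝓡 n)]
    exact Set.inter_subset_left
  · intro p hp
    have h1 : r (ψ p) = ψ p := hu _ hp.2
    rw [Function.comp_apply, h1]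
    exact ψ.left_inv hp.1

section Sections

variable {m n : ℕ} {M : Type*} [TopologicalSpace M] [ChartedSpace (EuclideanSpace ℝ (Fin m)) M]
  {N : Type*} [TopologicalSpace N] [ChartedSpace (EuclideanSpace ℝ (Fin n)) N]
  [IsManifold (𝓡 n) ∞ N]
  {F : Type*} [NormedAddCommGroup F] [NormedSpace ℝ F]
  {V : M → Type*} [TopologicalSpace (Bundle.TotalSpace F V)]
  [∀ x, AddCommGroup (V x)] [∀ x, Module ℝ (V x)] [∀ x, TopologicalSpace (V x)]
  [FiberBundle F V] [VectorBundle ℝ F V] [ContMDiffVectorBundle ∞ F V (𝓡 m)]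

theorem mem_sections_ofVectorBundle_iff [IsManifold (𝓡 m) ∞ M] {s : ∀ x, V x} :
    s ∈ (ofVectorBundle (𝓡 m) F V).sections ↔
      ContMDiff (𝓡 m) ((𝓡 m).prod 𝓘(ℝ, F)) ∞
        fun x ↦ (⟨x, s x⟩ : Bundle.TotalSpace F V) := by
  refine ⟨fun h x₀ ↦ ?_, fun h k c hc ↦ h.comp hc⟩
  obtain ⟨c, φ, U, hc, hU, hx₀, hφ, hcφ⟩ := exists_plot_nhds (n := m) x₀
  have h1 : ContMDiff (𝓡 m) ((𝓡 m).prod 𝓘(ℝ, F)) ∞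
      fun y ↦ (⟨c y, s (c y)⟩ : Bundle.TotalSpace F V) := h m c hc
  refine ((h1 _).comp x₀ ((hφ x₀ hx₀).contMDiffAt (hU.mem_nhds hx₀))).congr_of_eventuallyEq ?_
  filter_upwards [hU.mem_nhds hx₀] with x hx
  rw [Function.comp_apply, hcφ x hx]

/-- A section of `V / D` along a map `f` that is smooth on plots has local lifts to smooth sections
of `V` along `f`. -/
theorem exists_local_lift_of_plots {D : ∀ x, Submodule ℝ (V x)} {f : N → M}
    {s : ∀ p, V (f p) ⧸ D (f p)}
    (hs : ∀ (k : ℕ) (c : EuclideanSpace ℝ (Fin k) → N), ContMDiff (𝓡 k) (𝓡 n) ∞ c →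
      (fun y ↦ (⟨f (c y), s (c y)⟩ : Σ x, V x ⧸ D x)) ∈
        ((ofVectorBundle (𝓡 m) F V).quotient D).diffeology.plots k) (p₀ : N) :
    ∃ U ∈ 𝓝 p₀, ∃ σ : ∀ p, V (f p),
      ContMDiffOn (𝓡 n) ((𝓡 m).prod 𝓘(ℝ, F)) ∞
        (fun p ↦ (⟨f p, σ p⟩ : Bundle.TotalSpace F V)) U ∧
      ∀ p ∈ U, Submodule.Quotient.mk (σ p) = s p := by
  obtain ⟨c, φ, U, hc, hU, hp₀, hφ, hcφ⟩ := exists_plot_nhds (n := n) p₀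
  obtain ⟨g, hg, hgs⟩ := hs n c hc (φ p₀)
  have hg' : ContMDiff (𝓡 n) ((𝓡 m).prod 𝓘(ℝ, F)) ∞
      fun y ↦ (⟨(g y).1, (g y).2⟩ : Bundle.TotalSpace F V) := hg
  obtain ⟨u, hu, huo, hpu⟩ := eventually_nhds_iff.mp hgs
  have aux : ∀ (x : M) (a : V x ⧸ D x) (z : Σ x, V x),
      (⟨z.1, Submodule.Quotient.mk z.2⟩ : Σ x, V x ⧸ D x) = ⟨x, a⟩ →
        ∃ w : V x, z = ⟨x, w⟩ ∧ Submodule.Quotient.mk w = a := by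
    rintro x a ⟨x', w⟩ h
    obtain ⟨rfl, h2⟩ := Sigma.mk.inj_iff.mp h
    exact ⟨w, rfl, eq_of_heq h2⟩
  have key : ∀ p, ∃ w : V (f p), p ∈ U ∩ φ ⁻¹' u →
      g (φ p) = ⟨f p, w⟩ ∧ Submodule.Quotient.mk w = s p := by
    intro p
    by_cases hp : p ∈ U ∩ φ ⁻¹' u
    · have h1 : (⟨(g (φ p)).1, Submodule.Quotient.mk (g (φ p)).2⟩ : Σ x, V x ⧸ D x) =
          (fun p ↦ (⟨f p, s p⟩ : Σ x, V x ⧸ D x)) (c (φ p)) := hu (φ p) hp.2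
      rw [hcφ p hp.1] at h1
      obtain ⟨w, hw⟩ := aux _ _ _ h1
      exact ⟨w, fun _ ↦ hw⟩
    · exact ⟨0, fun h ↦ absurd h hp⟩
  choose σ hσ using key
  refine ⟨U ∩ φ ⁻¹' u, (hφ.continuousOn.isOpen_inter_preimage hU huo).mem_nhds ⟨hp₀, hpu⟩, σ,
    ?_, fun p hp ↦ (hσ p hp).2⟩
  refine (hg'.comp_contMDiffOn (hφ.mono Set.inter_subset_left)).congr fun p hp ↦ ?_
  rw [Function.comp_apply, (hσ p hp).1]

theorem convex_setOf_mk_eq {W : Type*} [AddCommGroup W] [Module ℝ W] (S : Submodule ℝ W)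
    (a : W ⧸ S) : Convex ℝ {v : W | Submodule.Quotient.mk v = a} := by
  intro v hv w hw t u _ _ htu
  have hv' : S.mkQ v = a := hv
  have hw' : S.mkQ w = a := hw
  change S.mkQ (t • v + u • w) = a
  rw [map_add, map_smul, map_smul, hv', hw', ← add_smul, htu, one_smul]

theorem mem_sections_quotient_iff [FiniteDimensional ℝ F] [IsManifold (𝓡 m) ∞ M] [T2Space M]
    [SecondCountableTopology M] {D : ∀ x, Submodule ℝ (V x)} {s : ∀ x, V x ⧸ D x} :
    s ∈ ((ofVectorBundle (𝓡 m) F V).quotient D).sections ↔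
      ∃ σ : Cₛ^∞⟮𝓡 m; F, V⟯, ∀ x, Submodule.Quotient.mk (σ x) = s x := by
  constructor
  · intro h
    have : LocallyCompactSpace M := ChartedSpace.locallyCompactSpace (EuclideanSpace ℝ (Fin m)) M
    refine exists_contMDiffSection_forall_mem_convex_of_local (𝓡 m) (n := ⊤) V
      (fun x ↦ {v | Submodule.Quotient.mk v = s x}) (fun x ↦ convex_setOf_mk_eq _ _) fun x₀ ↦ ?_
    exact exists_local_lift_of_plots (f := fun x : M ↦ x) (fun k c hc ↦ h k c hc) x₀
  · rintro ⟨σ, hσ⟩ k c hc x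
    exact ⟨fun y ↦ ⟨c y, σ (c y)⟩, σ.contMDiff.comp hc, Filter.Eventually.of_forall fun y ↦
      Sigma.ext rfl (heq_of_eq (hσ (c y)))⟩

theorem contMDiffAt_pullback_section_iff (π : C^∞⟮𝓡 n, N; 𝓡 m, M⟯) {s : ∀ p, V (π p)} {p₀ : N} :
    ContMDiffAt (𝓡 n) ((𝓡 n).prod 𝓘(ℝ, F)) ∞
      (fun p ↦ (⟨p, s p⟩ : Bundle.TotalSpace F (π *ᵖ V))) p₀ ↔
    ContMDiffAt (𝓡 n) ((𝓡 m).prod 𝓘(ℝ, F)) ∞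
      (fun p ↦ (⟨π p, s p⟩ : Bundle.TotalSpace F V)) p₀ := by
  refine (Bundle.contMDiffAt_section (E := π *ᵖ V) p₀).trans
    (Iff.trans ?_ Bundle.contMDiffAt_totalSpace.symm)
  exact ⟨fun h ↦ ⟨π.contMDiff p₀, h⟩, fun h ↦ h.2⟩

theorem mem_sections_pullback_quotient_iff [FiniteDimensional ℝ F] [T2Space N]
    [SecondCountableTopology N] {D : ∀ x, Submodule ℝ (V x)} (π : C^∞⟮𝓡 n, N; 𝓡 m, M⟯)
    {s : ∀ p, V (π p) ⧸ D (π p)} :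
    s ∈ (((ofVectorBundle (𝓡 m) F V).quotient D).pullback π).sections ↔
      ∃ σ : Cₛ^∞⟮𝓡 n; F, π *ᵖ V⟯, ∀ p, Submodule.Quotient.mk (p := D (π p)) (σ p) = s p := by
  constructor
  · intro h
    have : LocallyCompactSpace N := ChartedSpace.locallyCompactSpace (EuclideanSpace ℝ (Fin n)) N
    refine exists_contMDiffSection_forall_mem_convex_of_local (𝓡 n) (n := ⊤) (π *ᵖ V)
      (fun p ↦ {v : V (π p) | Submodule.Quotient.mk v = s p})
      (fun p ↦ convex_setOf_mk_eq (D (π p)) (s p)) fun p₀ ↦ ?_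
    obtain ⟨U, hU, σ, hσ, hσs⟩ := exists_local_lift_of_plots (f := π)
      (fun k c hc ↦ (h k c hc).2) p₀
    refine ⟨interior U, interior_mem_nhds.mpr hU, σ, fun p hp ↦ ?_,
      fun p hp ↦ hσs p (interior_subset hp)⟩
    exact ((contMDiffAt_pullback_section_iff π).mpr ((hσ p (interior_subset hp)).contMDiffAt
      (mem_interior_iff_mem_nhds.mp hp))).contMDiffWithinAt
  · rintro ⟨σ, hσ⟩ k c hc
    refine ⟨hc, fun x ↦ ?_⟩
    have h1 : ContMDiff (𝓡 n) ((𝓡 m).prod 𝓘(ℝ, F)) ∞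
        (fun p ↦ (⟨π p, σ p⟩ : Bundle.TotalSpace F V)) :=
      fun p ↦ (contMDiffAt_pullback_section_iff π).mp (σ.contMDiff p)
    exact ⟨fun y ↦ ⟨π (c y), σ (c y)⟩, h1.comp hc, Filter.Eventually.of_forall fun y ↦
      Sigma.ext rfl (heq_of_eq (hσ (c y)))⟩

end Sections

/-! ### Generators of the sections of a pulled back subbundle -/

section Generators

variable {m n : ℕ} {M : Type*} [TopologicalSpace M] [ChartedSpace (EuclideanSpace ℝ (Fin m)) M]
  [IsManifold (𝓡 m) ∞ M]
  {P : Type*} [TopologicalSpace P] [ChartedSpace (EuclideanSpace ℝ (Fin n)) P]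
  [IsManifold (𝓡 n) ∞ P]
  {F : Type*} [NormedAddCommGroup F] [NormedSpace ℝ F]
  {V : M → Type*} [TopologicalSpace (Bundle.TotalSpace F V)]
  [∀ x, AddCommGroup (V x)] [∀ x, Module ℝ (V x)] [∀ x, TopologicalSpace (V x)]
  [FiberBundle F V] [VectorBundle ℝ F V] [ContMDiffVectorBundle ∞ F V (𝓡 m)]

variable (m F) in
/-- The sections `δ j` generate the module of global smooth sections with values in `D`. -/
def GeneratesGlobalSections (D : ∀ x, Submodule ℝ (V x)) {k : ℕ} (δ : Fin k → ∀ x, V x) : Prop :=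
  ∀ s : Cₛ^∞⟮𝓡 m; F, V⟯, (∀ x, s x ∈ D x) →
    ∃ h : Fin k → C^∞⟮𝓡 m, M; ℝ⟯, ∀ x, s x = ∑ j, h j x • δ j x

/-- A compactly supported section over a chart domain extends by zero. -/
theorem GeneratesGlobalSections.generatesSections [T2Space M] {D : ∀ x, Submodule ℝ (V x)} {k : ℕ}
    {δ : Fin k → ∀ x, V x} (hδ : GeneratesGlobalSections m F D δ)
    {ψ : OpenPartialHomeomorph M (EuclideanSpace ℝ (Fin m))}
    (hψ : ψ ∈ IsManifold.maximalAtlas (𝓡 m) ∞ M) (x₀ : M) :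
    GeneratesSections (ψ.target ∩ ψ.symm ⁻¹' (trivializationAt F V x₀).baseSet)
      (fun z ↦ (D (ψ.symm z)).comap ((trivializationAt F V x₀).symmₗ ℝ (ψ.symm z)))
      fun j z ↦ (trivializationAt F V x₀ ⟨ψ.symm z, δ j (ψ.symm z)⟩).2 := by
  classical
  set t := trivializationAt F V x₀ with ht
  intro s hs hc hsU hsD
  have hUo : IsOpen (ψ.target ∩ ψ.symm ⁻¹' t.baseSet) :=
    ψ.isOpen_inter_preimage_symm t.open_baseSet
  let S : ∀ y, V y := fun y ↦ if y ∈ ψ.source then t.symmₗ ℝ y (s (ψ y)) else 0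
  have hK : IsCompact (ψ.symm '' tsupport s) :=
    hc.isCompact.image_of_continuousOn (ψ.continuousOn_symm.mono fun z hz ↦ (hsU hz).1)
  have hS0 : ∀ y, y ∉ ψ.symm '' tsupport s → S y = 0 := by
    intro y hy
    by_cases hyψ : y ∈ ψ.source
    · have : s (ψ y) = 0 := image_eq_zero_of_notMem_tsupport fun h ↦
        hy ⟨ψ y, h, ψ.left_inv hyψ⟩
      simp [S, this]
    · simp [S, hyψ]
  have hSsm : ContMDiff (𝓡 m) ((𝓡 m).prod 𝓘(ℝ, F)) ∞
      fun y ↦ (⟨y, S y⟩ : Bundle.TotalSpace F V) := by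
    intro y
    by_cases hy : y ∈ ψ.symm '' tsupport s
    · obtain ⟨z, hz, rfl⟩ := hy
      have h1 : ψ.symm z ∈ ψ.source := ψ.map_target (hsU hz).1
      have h2 : ψ.symm z ∈ t.baseSet := (hsU hz).2
      refine (t.contMDiffAt_section_iff (IB := 𝓡 m) h2).mpr ?_
      have h3 : ContMDiffAt (𝓡 m) 𝓘(ℝ, F) ∞ (s ∘ ψ) (ψ.symm z) :=
        hs.contMDiff.contMDiffAt.comp _ ((contMDiffOn_of_mem_maximalAtlas hψ _ h1).contMDiffAt
          (ψ.open_source.mem_nhds h1))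
      refine h3.congr_of_eventuallyEq ?_
      filter_upwards [ψ.open_source.mem_nhds h1, t.open_baseSet.mem_nhds h2] with y hy hyt
      have h4 : S y = t.symm y (s (ψ y)) := by
        simp only [S, if_pos hy]
        rw [← t.coe_symmₗ (R := ℝ) hyt]
      rw [h4, t.apply_mk_symm hyt]
      rfl
    · have h0 : ContMDiffAt (𝓡 m) ((𝓡 m).prod 𝓘(ℝ, F)) ∞
          (fun y ↦ (⟨y, 0⟩ : Bundle.TotalSpace F V)) y :=
        Bundle.contMDiff_zeroSection ℝ V y
      refine h0.congr_of_eventuallyEq ?_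
      filter_upwards [hK.isClosed.isOpen_compl.mem_nhds hy] with y' hy'
      rw [hS0 y' hy']
  obtain ⟨h, hh⟩ := hδ ⟨S, hSsm⟩ fun y ↦ by
    by_cases hy : y ∈ ψ.source
    · have h1 : t.symmₗ ℝ (ψ.symm (ψ y)) (s (ψ y)) ∈ D (ψ.symm (ψ y)) := hsD (ψ y)
      rw [ψ.left_inv hy] at h1
      simpa [S, hy] using h1
    · simp [S, hy]
  obtain ⟨χ, K', hχ, hK', hK'U, hχ1, hχ0⟩ := exists_cutoff hc.isCompact hUo hsU
  refine ⟨fun z j ↦ χ z * h j (ψ.symm z), contDiff_pi.mpr fun j ↦ contDiff_iff_contDiffAt.mpr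
    fun z ↦ ?_, fun z ↦ ?_⟩
  · by_cases hz : z ∈ K'
    · have h1 : ContMDiffAt (𝓡 m) (𝓡 m) ∞ ψ.symm z :=
        (contMDiffOn_symm_of_mem_maximalAtlas hψ z (hK'U hz).1).contMDiffAt
          (ψ.open_target.mem_nhds (hK'U hz).1)
      exact hχ.contDiffAt.mul ((h j).contMDiff.contMDiffAt.comp z h1).contDiffAt
    · refine (contDiffAt_const (c := (0 : ℝ))).congr_of_eventuallyEq ?_
      filter_upwards [hK'.isClosed.isOpen_compl.mem_nhds hz] with z' hz'
      simp [hχ0 z' hz']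
  · have hχs : s z = χ z • s z := by
      by_cases hz : z ∈ tsupport s
      · rw [hχ1 z hz, one_smul]
      · rw [image_eq_zero_of_notMem_tsupport hz, smul_zero]
    by_cases hz : z ∈ ψ.target ∩ ψ.symm ⁻¹' t.baseSet
    · have h1 : S (ψ.symm z) = t.symm (ψ.symm z) (s z) := by
        simp only [S, if_pos (ψ.map_target hz.1), ψ.right_inv hz.1]
        rw [← t.coe_symmₗ (R := ℝ) hz.2]
      have h2 : s z = (t ⟨ψ.symm z, S (ψ.symm z)⟩).2 := by
        rw [h1, t.apply_mk_symm hz.2]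
      have h3 : S (ψ.symm z) = ∑ j, h j (ψ.symm z) • δ j (ψ.symm z) := hh (ψ.symm z)
      have h4 : ∀ v, (t ⟨ψ.symm z, v⟩).2 = t.linearEquivAt ℝ (ψ.symm z) hz.2 v := fun v ↦ rfl
      rw [hχs, h2, h3]
      simp only [h4, map_sum, map_smul, Finset.smul_sum, smul_smul]
      rfl
    · have h0 : χ z = 0 := hχ0 z fun h ↦ hz (hK'U h)
      rw [hχs, h0]
      simp [h0]

/-- In charts in which the submersion `π` is a linear projection, a section of `π^* D` is a family
of sections of `D` that depends on parameters. -/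
theorem exists_local_coefficients [T2Space M] [FiniteDimensional ℝ F]
    {D : ∀ x, Submodule ℝ (V x)} {k : ℕ}
    {δ : Fin k → ∀ x, V x} (hδ : GeneratesGlobalSections m F D δ)
    (π : C^∞⟮𝓡 n, P; 𝓡 m, M⟯) (hπ : Manifold.IsSubmersion (𝓡 n) (𝓡 m) ∞ π)
    {τ : ∀ p, V (π p)} (hτsm : ContMDiff (𝓡 n) ((𝓡 m).prod 𝓘(ℝ, F)) ∞
      fun p ↦ (⟨π p, τ p⟩ : Bundle.TotalSpace F V)) (hτ : ∀ p, τ p ∈ D (π p)) (p₀ : P) :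
    ∃ U ∈ 𝓝 p₀, ∃ g : P → Fin k → ℝ, ContMDiffOn (𝓡 n) 𝓘(ℝ, Fin k → ℝ) ∞ g U ∧
      ∀ p ∈ U, ∑ j, g p j • δ j (π p) = τ p := by
  obtain ⟨Y, _, _, hY⟩ := hπ
  have h := hY p₀
  set φ := h.domChart with hφ_def
  set ψ := h.codChart with hψ_def
  set L := h.equiv with hL
  have hφ := h.domChart_mem_maximalAtlas
  have hψ := h.codChart_mem_maximalAtlas
  have hYfin : FiniteDimensional ℝ Y :=
    Module.Finite.of_surjective (LinearMap.snd ℝ _ Y ∘ₗ L.toLinearMap)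
      (Prod.snd_surjective.comp L.surjective)
  have hLφ : ∀ z ∈ φ.target, (L z).1 = ψ (π (φ.symm z)) := fun z hz ↦
    (h.writtenInCharts (by simpa using hz)).symm
  have hsource : ∀ z ∈ φ.target, π (φ.symm z) ∈ ψ.source := fun z hz ↦
    h.source_subset_preimage_source (φ.map_target hz)
  set t := trivializationAt F V (π p₀) with ht
  have hgen : GeneratesSections (L ⁻¹' ((ψ.target ∩ ψ.symm ⁻¹' t.baseSet) ×ˢ Set.univ))
      (fun z ↦ (D (ψ.symm (L z).1)).comap (t.symmₗ ℝ (ψ.symm (L z).1)))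
      fun j z ↦ (t ⟨ψ.symm (L z).1, δ j (ψ.symm (L z).1)⟩).2 :=
    ((hδ.generatesSections hψ (π p₀)).prod
      (ψ.isOpen_inter_preimage_symm t.open_baseSet) Y).comp_equiv L
  set O : Set (EuclideanSpace ℝ (Fin n)) := φ.target ∩ φ.symm ⁻¹' (π ⁻¹' t.baseSet) with hO
  have hOo : IsOpen O :=
    φ.isOpen_inter_preimage_symm (t.open_baseSet.preimage π.contMDiff.continuous)
  have hp₀ : φ p₀ ∈ O := by
    refine ⟨φ.map_source h.mem_domChart_source, ?_⟩
    rw [Set.mem_preimage, φ.left_inv h.mem_domChart_source]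
    exact FiberBundle.mem_baseSet_trivializationAt' (π p₀)
  have hψO : ∀ z ∈ O, ψ.symm (L z).1 = π (φ.symm z) := fun z hz ↦ by
    rw [hLφ z hz.1, ψ.left_inv (hsource z hz.1)]
  obtain ⟨ε, hε, hball⟩ := Metric.nhds_basis_closedBall.mem_iff.mp (hOo.mem_nhds hp₀)
  obtain ⟨χ, K', hχ, hK', hK'O, hχ1, hχ0⟩ :=
    exists_cutoff (isCompact_closedBall (φ p₀) ε) hOo hball
  let s : EuclideanSpace ℝ (Fin n) → F := fun z ↦
    χ z • (t ⟨π (φ.symm z), τ (φ.symm z)⟩).2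
  have hs0 : ∀ z, z ∉ K' → s z = 0 := fun z hz ↦ by simp [s, hχ0 z hz]
  have hs : ContDiff ℝ ∞ s := by
    refine contDiff_iff_contDiffAt.mpr fun z ↦ ?_
    by_cases hz : z ∈ K'
    · have hzO := hK'O hz
      have h1 : ContMDiffAt (𝓡 n) (𝓡 n) ∞ φ.symm z :=
        (contMDiffOn_symm_of_mem_maximalAtlas hφ z hzO.1).contMDiffAt
          (φ.open_target.mem_nhds hzO.1)
      have h2 : ContMDiffAt (𝓡 n) ((𝓡 m).prod 𝓘(ℝ, F)) ∞
          (fun z ↦ (⟨π (φ.symm z), τ (φ.symm z)⟩ : Bundle.TotalSpace F V)) z :=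
        (hτsm _).comp z h1
      have hmem : (⟨π (φ.symm z), τ (φ.symm z)⟩ : Bundle.TotalSpace F V) ∈ t.source :=
        t.mem_source.mpr hzO.2
      have h3 : ContMDiffAt (𝓡 n) 𝓘(ℝ, F) ∞
          (fun z ↦ (t ⟨π (φ.symm z), τ (φ.symm z)⟩).2) z :=
        contMDiffAt_snd.comp z (((t.contMDiffOn (n := ∞) (IB := 𝓡 m) _ hmem).contMDiffAt
          (t.open_source.mem_nhds hmem)).comp z h2)
      exact hχ.contDiffAt.smul h3.contDiffAt
    · refine (contDiffAt_const (c := (0 : F))).congr_of_eventuallyEq ?_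
      filter_upwards [hK'.isClosed.isOpen_compl.mem_nhds hz] with z' hz'
      exact hs0 z' hz'
  have hsupp : tsupport s ⊆ K' :=
    closure_minimal (fun z hz ↦ by_contra fun h ↦ hz (hs0 z h)) hK'.isClosed
  obtain ⟨f, hf, hfs⟩ := hgen s hs (hK'.of_isClosed_subset (isClosed_tsupport s) hsupp) (by
    intro z hz
    have hzO := hK'O (hsupp hz)
    refine ⟨⟨?_, ?_⟩, trivial⟩
    · rw [hLφ z hzO.1]
      exact ψ.map_source (hsource z hzO.1)
    · rw [Set.mem_preimage, hψO z hzO]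
      exact hzO.2) (by
    intro z
    by_cases hz : z ∈ O
    · beta_reduce
      rw [hψO z hz]
      refine Submodule.smul_mem _ _ ?_
      rw [Submodule.mem_comap, t.coe_symmₗ (R := ℝ) hz.2, t.symm_apply_apply_mk hz.2]
      exact hτ _
    · rw [hs0 z fun h ↦ hz (hK'O h)]
      exact Submodule.zero_mem _)
  refine ⟨φ.source ∩ φ ⁻¹' Metric.ball (φ p₀) ε,
    (φ.isOpen_inter_preimage Metric.isOpen_ball).mem_nhds
      ⟨h.mem_domChart_source, Metric.mem_ball_self hε⟩, f ∘ φ,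
    hf.contMDiff.comp_contMDiffOn ((contMDiffOn_of_mem_maximalAtlas hφ).mono
      Set.inter_subset_left), ?_⟩
  intro p hp
  have hpO : φ p ∈ O := hball (Metric.ball_subset_closedBall hp.2)
  have h1 := hfs (φ p)
  beta_reduce at h1
  rw [hψO _ hpO] at h1
  have hpt : π p ∈ t.baseSet := by
    have := hpO.2
    rwa [Set.mem_preimage, Set.mem_preimage, φ.left_inv hp.1] at this
  simp only [s, hχ1 _ (Metric.ball_subset_closedBall hp.2), one_smul] at h1
  rw [φ.left_inv hp.1] at h1
  have h4 : ∀ v, (t ⟨π p, v⟩).2 = t.linearEquivAt ℝ (π p) hpt v := fun v ↦ rfl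
  apply (t.linearEquivAt ℝ (π p) hpt).injective
  rw [map_sum]
  simp only [map_smul]
  simp only [← h4]
  exact h1.symm

/-- Pulling back along a submersion preserves generators of the module of sections of a singular
subbundle. -/
theorem exists_coefficients_of_isSubmersion [T2Space M] [FiniteDimensional ℝ F] [T2Space P]
    [SecondCountableTopology P] {D : ∀ x, Submodule ℝ (V x)} {k : ℕ}
    {δ : Fin k → ∀ x, V x} (hδ : GeneratesGlobalSections m F D δ)
    (π : C^∞⟮𝓡 n, P; 𝓡 m, M⟯) (hπ : Manifold.IsSubmersion (𝓡 n) (𝓡 m) ∞ π)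
    {τ : ∀ p, V (π p)} (hτsm : ContMDiff (𝓡 n) ((𝓡 m).prod 𝓘(ℝ, F)) ∞
      fun p ↦ (⟨π p, τ p⟩ : Bundle.TotalSpace F V)) (hτ : ∀ p, τ p ∈ D (π p)) :
    ∃ g : Fin k → C^∞⟮𝓡 n, P; ℝ⟯, ∀ p, ∑ j, g j p • δ j (π p) = τ p := by
  have : LocallyCompactSpace P := ChartedSpace.locallyCompactSpace (EuclideanSpace ℝ (Fin n)) P
  obtain ⟨g, hg⟩ := exists_contMDiffMap_forall_mem_convex_of_local (𝓡 n) (n := ⊤)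
    (t := fun p ↦ {c : Fin k → ℝ | ∑ j, c j • δ j (π p) = τ p}) (fun p ↦ by
      intro c hc d hd a b _ _ hab
      have hc' : ∑ j, c j • δ j (π p) = τ p := hc
      have hd' : ∑ j, d j • δ j (π p) = τ p := hd
      change ∑ j, (a * c j + b * d j) • δ j (π p) = τ p
      simp only [add_smul, mul_smul, Finset.sum_add_distrib, ← Finset.smul_sum, hc', hd']
      rw [← add_smul, hab, one_smul]) fun p₀ ↦ exists_local_coefficients hδ π hπ hτsm hτ p₀
  exact ⟨fun j ↦ ⟨fun p ↦ g p j, contMDiff_pi_space.mp g.contMDiff j⟩, hg⟩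

end Generators

/-! ### Base change of modules of sections -/

section BaseChange

variable {m n : ℕ} {M : Type*} [TopologicalSpace M] [ChartedSpace (EuclideanSpace ℝ (Fin m)) M]
  {P : Type*} [TopologicalSpace P] [ChartedSpace (EuclideanSpace ℝ (Fin n)) P]

namespace AlgebraicPullback

variable (π : C^∞⟮𝓡 n, P; 𝓡 m, M⟯) {Q : Type*} [AddCommGroup Q] [Module C^∞⟮𝓡 m, M; ℝ⟯ Q]

theorem tmul_smul (f : C^∞⟮𝓡 n, P; ℝ⟯) (g : C^∞⟮𝓡 m, M; ℝ⟯) (q : Q) :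
    tmul π f (g • q) = tmul π (f * g.comp π) q := by
  let := comorphismAlgebra π
  have h : f * g.comp π = g • f := by
    rw [Algebra.smul_def, mul_comm]
    rfl
  rw [h]
  exact (TensorProduct.smul_tmul g f q).symm

theorem sum_tmul {ι : Type*} (s : Finset ι) (f : ι → C^∞⟮𝓡 n, P; ℝ⟯) (q : Q) :
    tmul π (∑ i ∈ s, f i) q = ∑ i ∈ s, tmul π (f i) q :=
  letI := comorphismAlgebra π
  TensorProduct.sum_tmul s f q

theorem tmul_sum {ι : Type*} (s : Finset ι) (f : C^∞⟮𝓡 n, P; ℝ⟯) (q : ι → Q) :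
    tmul π f (∑ i ∈ s, q i) = ∑ i ∈ s, tmul π f (q i) :=
  letI := comorphismAlgebra π
  TensorProduct.tmul_sum f s q

theorem sub_tmul (f g : C^∞⟮𝓡 n, P; ℝ⟯) (q : Q) :
    tmul π (f - g) q = tmul π f q - tmul π g q :=
  letI := comorphismAlgebra π
  TensorProduct.sub_tmul f g q

theorem zero_tmul (q : Q) : tmul π 0 q = 0 :=
  letI := comorphismAlgebra π
  TensorProduct.zero_tmul _ q

theorem tmul_zero (f : C^∞⟮𝓡 n, P; ℝ⟯) : tmul π f (0 : Q) = 0 :=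
  letI := comorphismAlgebra π
  TensorProduct.tmul_zero _ f

theorem exists_eq_sum_tmul {N : ℕ} {q : Fin N → Q}
    (hq : ∀ x : Q, ∃ g : Fin N → C^∞⟮𝓡 m, M; ℝ⟯, x = ∑ a, g a • q a) (t : AlgebraicPullback π Q) :
    ∃ f : Fin N → C^∞⟮𝓡 n, P; ℝ⟯, t = ∑ a, tmul π (f a) (q a) := by
  let := comorphismAlgebra π
  induction t using TensorProduct.induction_on with
  | zero => exact ⟨0, by simp⟩
  | tmul f x =>
    obtain ⟨g, rfl⟩ := hq x
    refine ⟨fun a ↦ f * (g a).comp π, ?_⟩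
    simp only [← tmul_smul, ← tmul_sum]
  | add t t' h h' =>
    obtain ⟨f, rfl⟩ := h
    obtain ⟨f', rfl⟩ := h'
    refine ⟨f + f', ?_⟩
    rw [← Finset.sum_add_distrib]
    exact Finset.sum_congr rfl fun a _ ↦ (TensorProduct.add_tmul _ _ _).symm

end AlgebraicPullback

namespace VectorSpaceBundle

theorem sections_sum_smul_apply (B : VectorSpaceBundle (𝓡 m) M) {ι : Type*} (s : Finset ι)
    (g : ι → C^∞⟮𝓡 m, M; ℝ⟯) (q : ι → B.sections) (x : M) :
    (∑ i ∈ s, g i • q i : B.sections).1 x = ∑ i ∈ s, g i x • (q i).1 x := by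
  classical
  induction s using Finset.induction_on with
  | empty => rfl
  | insert i s hi ih =>
    rw [Finset.sum_insert hi, Finset.sum_insert hi, ← ih]
    rfl

theorem alpha_sum_tmul_apply (π : C^∞⟮𝓡 n, P; 𝓡 m, M⟯) (B : VectorSpaceBundle (𝓡 m) M) {N : ℕ}
    (f : Fin N → C^∞⟮𝓡 n, P; ℝ⟯) (q : Fin N → B.sections) (p : P) :
    (B.alpha π (∑ a, AlgebraicPullback.tmul π (f a) (q a))).1 p =
      ∑ a, f a p • (q a).1 (π p) := by
  rw [map_sum]
  simp only [alpha_tmul]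
  exact sections_sum_smul_apply (B.pullback π) _ _ _ p

end VectorSpaceBundle

variable [IsManifold (𝓡 m) ∞ M] [T2Space M] [SecondCountableTopology M]
  {F : Type*} [NormedAddCommGroup F] [NormedSpace ℝ F]
  {V : M → Type*} [TopologicalSpace (Bundle.TotalSpace F V)]
  [∀ x, AddCommGroup (V x)] [∀ x, Module ℝ (V x)] [∀ x, TopologicalSpace (V x)]
  [FiberBundle F V] [VectorBundle ℝ F V] [ContMDiffVectorBundle ∞ F V (𝓡 m)]

theorem exists_generatesGlobalSections {D : ∀ x, Submodule ℝ (V x)}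
    (hfg : Module.Finite C^∞⟮𝓡 m, M; ℝ⟯ ((ofVectorBundle (𝓡 m) F V).sub D).sections) :
    ∃ k, ∃ δ : Fin k → Cₛ^∞⟮𝓡 m; F, V⟯, (∀ j x, δ j x ∈ D x) ∧
      GeneratesGlobalSections m F D fun j x ↦ δ j x := by
  obtain ⟨k, d, hd⟩ := hfg.exists_fin
  have hsm : ∀ j, ContMDiff (𝓡 m) ((𝓡 m).prod 𝓘(ℝ, F)) ∞
      fun x ↦ (⟨x, ((d j).1 x).1⟩ : Bundle.TotalSpace F V) := fun j ↦
    mem_sections_ofVectorBundle_iff.mp fun l c hc ↦ (d j).2 l c hc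
  refine ⟨k, fun j ↦ ⟨fun x ↦ ((d j).1 x).1, hsm j⟩, fun j x ↦ ((d j).1 x).2, fun s hs ↦ ?_⟩
  let S : ((ofVectorBundle (𝓡 m) F V).sub D).sections :=
    ⟨fun x ↦ ⟨s x, hs x⟩, fun l c hc ↦ s.contMDiff.comp hc⟩
  have hS : S ∈ Submodule.span C^∞⟮𝓡 m, M; ℝ⟯ (Set.range d) := hd ▸ Submodule.mem_top
  obtain ⟨h, hh⟩ := Submodule.mem_span_range_iff_exists_fun _ |>.mp hS
  refine ⟨h, fun x ↦ ?_⟩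
  have h1 := ((ofVectorBundle (𝓡 m) F V).sub D).sections_sum_smul_apply Finset.univ h d x
  rw [hh] at h1
  exact (congrArg (D x).subtype h1).trans
    (map_sum (D x).subtype (fun j ↦ h j x • (d j).1 x) Finset.univ)

variable [FiniteDimensional ℝ F] [IsManifold (𝓡 n) ∞ P] [T2Space P] [SecondCountableTopology P]

theorem alpha_quotient_bijective {D : ∀ x, Submodule ℝ (V x)}
    (hfg : Module.Finite C^∞⟮𝓡 m, M; ℝ⟯ ((ofVectorBundle (𝓡 m) F V).sub D).sections)
    (π : C^∞⟮𝓡 n, P; 𝓡 m, M⟯) (hπ : Manifold.IsSubmersion (𝓡 n) (𝓡 m) ∞ π) :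
    Function.Bijective (((ofVectorBundle (𝓡 m) F V).quotient D).alpha π) := by
  obtain ⟨N, A, hA, e, he⟩ := exists_finite_frame (m := m) (F := F) (V := V)
  obtain ⟨k, δ, hδD, hδ⟩ := exists_generatesGlobalSections hfg
  set B := (ofVectorBundle (𝓡 m) F V).quotient D with hB
  let cls (σ : Cₛ^∞⟮𝓡 m; F, V⟯) : B.sections :=
    ⟨fun x ↦ Submodule.Quotient.mk (σ x), mem_sections_quotient_iff.mpr ⟨σ, fun _ ↦ rfl⟩⟩
  -- the coordinates of a section with respect to the frame
  let coord (σ : Cₛ^∞⟮𝓡 m; F, V⟯) (a : Fin N) : C^∞⟮𝓡 m, M; ℝ⟯ :=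
    ⟨fun x ↦ A x (σ x) a, contMDiff_pi_space.mp (hA.comp σ.contMDiff) a⟩
  have hcls : ∀ σ, cls σ = ∑ a, coord σ a • cls (e a) := by
    intro σ
    refine Subtype.ext (funext fun x ↦ ?_)
    rw [B.sections_sum_smul_apply]
    have h1 := congrArg (D x).mkQ (he x (σ x))
    rw [map_sum] at h1
    exact h1.symm
  have hgen : ∀ q : B.sections, ∃ g : Fin N → C^∞⟮𝓡 m, M; ℝ⟯, q = ∑ a, g a • cls (e a) := by
    intro q
    obtain ⟨σ, hσ⟩ := mem_sections_quotient_iff.mp q.2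
    refine ⟨coord σ, ?_⟩
    rw [← hcls]
    exact Subtype.ext (funext fun x ↦ (hσ x).symm)
  have htmul : ∀ (f : C^∞⟮𝓡 n, P; ℝ⟯) σ, AlgebraicPullback.tmul π f (cls σ) =
      ∑ a, AlgebraicPullback.tmul π (f * (coord σ a).comp π) (cls (e a)) := by
    intro f σ
    conv_lhs => rw [hcls σ]
    simp only [AlgebraicPullback.tmul_sum, AlgebraicPullback.tmul_smul]
  have hsm : ∀ f : Fin N → C^∞⟮𝓡 n, P; ℝ⟯, ContMDiff (𝓡 n) ((𝓡 m).prod 𝓘(ℝ, F)) ∞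
      fun p ↦ (⟨π p, ∑ a, f a p • e a (π p)⟩ : Bundle.TotalSpace F V) := by
    intro f p
    refine Bundle.contMDiffAt_totalSpace.mpr ⟨π.contMDiff p, ?_⟩
    set t := trivializationAt F V (π p)
    have h1 : ContMDiffAt (𝓡 n) 𝓘(ℝ, F) ∞
        (fun p' ↦ ∑ a, f a p' • (t ⟨π p', e a (π p')⟩).2) p :=
      contMDiffAt_finsetSum fun a _ ↦ ((f a).contMDiff p).smul
        (Bundle.contMDiffAt_totalSpace.mp (((e a).contMDiff (π p)).comp p (π.contMDiff p))).2
    refine h1.congr_of_eventuallyEq ?_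
    filter_upwards [π.contMDiff.continuous.continuousAt.preimage_mem_nhds
      (t.open_baseSet.mem_nhds (FiberBundle.mem_baseSet_trivializationAt' (π p)))] with p' hp'
    have h2 : ∀ v, (t ⟨π p', v⟩).2 = t.linearEquivAt ℝ (π p') hp' v := fun v ↦ rfl
    simp only [h2, map_sum, map_smul]
  constructor
  · rw [← LinearMap.ker_eq_bot, LinearMap.ker_eq_bot']
    intro t ht
    obtain ⟨f, rfl⟩ := AlgebraicPullback.exists_eq_sum_tmul π hgen t
    have hfD : ∀ p, ∑ a, f a p • e a (π p) ∈ D (π p) := by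
      intro p
      have h1 := B.alpha_sum_tmul_apply π f (fun a ↦ cls (e a)) p
      rw [ht] at h1
      rw [← Submodule.ker_mkQ (D (π p)), LinearMap.mem_ker, map_sum]
      exact h1.symm
    -- the section `∑ f a • e a ∘ π` of `π^* D`, in terms of the generators
    obtain ⟨h, hh⟩ := exists_coefficients_of_isSubmersion hδ π hπ (hsm f) hfD
    -- the classes of the generators of `Γ(D)` vanish
    have hδ0 : ∀ j, cls (δ j) = 0 := fun j ↦
      Subtype.ext (funext fun x ↦ (Submodule.Quotient.mk_eq_zero _).mpr (hδD j x))
    let c (a : Fin N) : C^∞⟮𝓡 n, P; ℝ⟯ := f a - ∑ j, h j * (coord (δ j) a).comp π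
    have hsumh : ∑ a, AlgebraicPullback.tmul π (∑ j, h j * (coord (δ j) a).comp π) (cls (e a)) =
        0 := by
      simp only [AlgebraicPullback.sum_tmul]
      rw [Finset.sum_comm]
      refine Finset.sum_eq_zero fun j _ ↦ ?_
      rw [← htmul, hδ0, AlgebraicPullback.tmul_zero]
    have hfc : ∑ a, AlgebraicPullback.tmul π (f a) (cls (e a)) =
        ∑ a, AlgebraicPullback.tmul π (c a) (cls (e a)) := by
      simp only [c, AlgebraicPullback.sub_tmul, Finset.sum_sub_distrib, hsumh, sub_zero]
    have hcapp : ∀ a p, c a p = f a p - ∑ j, h j p * A (π p) (δ j (π p)) a := by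
      intro a p
      have : (∑ j, h j * (coord (δ j) a).comp π) p = ∑ j, (h j * (coord (δ j) a).comp π) p :=
        map_sum (ContMDiffMap.evalRingHom p) _ _
      simp only [c, ContMDiffMap.coe_sub, Pi.sub_apply, this]
      rfl
    have hc0 : ∀ p, ∑ a, c a p • e a (π p) = 0 := by
      intro p
      simp only [hcapp, sub_smul, Finset.sum_sub_distrib, Finset.sum_smul, mul_smul]
      rw [Finset.sum_comm]
      simp only [← Finset.smul_sum, he]
      rw [sub_eq_zero]
      exact (hh p).symm
    -- The relation between the `e a` becomes trivial after `e b` is expanded in the frame.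
    rw [hfc, Finset.sum_congr rfl fun a _ ↦ htmul (c a) (e a), Finset.sum_comm]
    refine Finset.sum_eq_zero fun a _ ↦ ?_
    rw [← AlgebraicPullback.sum_tmul]
    have h0 : ∑ b, c b * (coord (e b) a).comp π = 0 := by
      ext p
      have h1 : (∑ b, c b * (coord (e b) a).comp π) p = ∑ b, (c b * (coord (e b) a).comp π) p :=
        map_sum (ContMDiffMap.evalRingHom p) _ _
      have h2 := congrFun (congrArg (A (π p)) (hc0 p)) a
      simp only [map_sum, map_smul, Finset.sum_apply, Pi.smul_apply, smul_eq_mul, map_zero,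
        Pi.zero_apply] at h2
      rw [h1]
      exact h2
    rw [h0, AlgebraicPullback.zero_tmul]
  · intro s
    obtain ⟨σ, hσ⟩ := (mem_sections_pullback_quotient_iff π).mp s.2
    have hσsm : ContMDiff (𝓡 n) ((𝓡 m).prod 𝓘(ℝ, F)) ∞
        (fun p ↦ (⟨π p, σ p⟩ : Bundle.TotalSpace F V)) :=
      fun p ↦ (contMDiffAt_pullback_section_iff π).mp (σ.contMDiff p)
    let f (a : Fin N) : C^∞⟮𝓡 n, P; ℝ⟯ :=
      ⟨fun p ↦ A (π p) (σ p) a, contMDiff_pi_space.mp (hA.comp hσsm) a⟩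
    refine ⟨∑ a, AlgebraicPullback.tmul π (f a) (cls (e a)), Subtype.ext (funext fun p ↦ ?_)⟩
    rw [B.alpha_sum_tmul_apply, ← hσ p]
    have h1 := congrArg (D (π p)).mkQ (he (π p) (σ p))
    rw [map_sum] at h1
    exact h1

/-- The bundles `π^* (V / D)` and `π^* V / π^* D` have the same fibres, and the same smooth
sections. -/
def pullbackQuotientSectionsEquiv (D : ∀ x, Submodule ℝ (V x)) (π : C^∞⟮𝓡 n, P; 𝓡 m, M⟯) :
    (((ofVectorBundle (𝓡 m) F V).quotient D).pullback π).sections ≃ₗ[C^∞⟮𝓡 n, P; ℝ⟯]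
      ((ofVectorBundle (𝓡 n) F (π *ᵖ V)).quotient fun p ↦ D (π p)).sections where
  toFun s := ⟨s.1, mem_sections_quotient_iff.mpr ((mem_sections_pullback_quotient_iff π).mp s.2)⟩
  invFun s := ⟨s.1, (mem_sections_pullback_quotient_iff π).mpr (mem_sections_quotient_iff.mp s.2)⟩
  map_add' _ _ := rfl
  map_smul' _ _ := rfl
  left_inv _ := rfl
  right_inv _ := rfl

end BaseChange

end Tepui

end

theorem proposition2p21 {m n : ℕ}
    {M : Type*} [TopologicalSpace M] [ChartedSpace (EuclideanSpace ℝ (Fin m)) M]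
    [IsManifold (𝓡 m) ∞ M] [T2Space M] [SecondCountableTopology M]
    {P : Type*} [TopologicalSpace P] [ChartedSpace (EuclideanSpace ℝ (Fin n)) P]
    [IsManifold (𝓡 n) ∞ P] [T2Space P] [SecondCountableTopology P]
    (F : Type*) [NormedAddCommGroup F] [NormedSpace ℝ F] [FiniteDimensional ℝ F]
    (V : M → Type*) [TopologicalSpace (Bundle.TotalSpace F V)]
    [∀ x, AddCommGroup (V x)] [∀ x, Module ℝ (V x)] [∀ x, TopologicalSpace (V x)]
    [FiberBundle F V] [VectorBundle ℝ F V] [ContMDiffVectorBundle ∞ F V (𝓡 m)]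
    (D : ∀ x, Submodule ℝ (V x)) (hD : Tepui.IsSmoothSubbundle (𝓡 m) F V D)
    (hfg : Module.Finite C^∞⟮𝓡 m, M; ℝ⟯ ((Tepui.ofVectorBundle (𝓡 m) F V).sub D).sections)
    (π : C^∞⟮𝓡 n, P; 𝓡 m, M⟯) (hπ : Manifold.IsSubmersion (𝓡 n) (𝓡 m) ∞ π) :
    Function.Bijective (((Tepui.ofVectorBundle (𝓡 m) F V).quotient D).alpha π) ∧
    ∃ e : Tepui.AlgebraicPullback π ((Tepui.ofVectorBundle (𝓡 m) F V).quotient D).sections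
        ≃ₗ[C^∞⟮𝓡 n, P; ℝ⟯]
        ((Tepui.ofVectorBundle (𝓡 n) F (π *ᵖ V)).quotient fun p ↦ D (π p)).sections,
      ∀ (f : C^∞⟮𝓡 n, P; ℝ⟯) (σ : ((Tepui.ofVectorBundle (𝓡 m) F V).quotient D).sections) (p : P),
        (e (Tepui.AlgebraicPullback.tmul π f σ)).1 p = f p • σ.1 (π p) := by
  have hbij := Tepui.alpha_quotient_bijective hfg π hπ
  refine ⟨hbij, (LinearEquiv.ofBijective _ hbij).trans
    (Tepui.pullbackQuotientSectionsEquiv D π), fun f σ p ↦ ?_⟩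
  have h1 := congrArg (fun s ↦ s.1 p)
    (((Tepui.ofVectorBundle (𝓡 m) F V).quotient D).alpha_tmul π f σ)
  exact h1
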